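/- Let $g\ge 3$. Let $\mathcal L$ be the infinite Jacob's ladder surface (two ends, both accumulated by genus), let $h_{g-1}$ be the handle shift of $\mathcal L$ by $g-1$ units, let $S_g=\mathcal L/\langle h_{g-1}\rangle$, which is the closed orientable surface of genus $g$, and let $q_g:\mathcal L\to S_g$ be the corresponding infinite cyclic covering map. (Concretely, one may take $\mathcal L=\{(x,y,z)\in\mathbb R^3: z^2=(4-y^2)(y^2+\sin^2(\pi x)-\tfrac14)\}$ and $h_{g-1}(x,y,z)=(x+g-1,y,z)$.) A singular measured foliation $(\mathcal F,\mu)$ on a surface is given, off its set of singularities, by a maximal atlas of charts to the $(x,y)$-plane with transition maps locally of the form $(x,y)\mapsto (h(x,y),c\pm y)$, the leaves being horizontal and the transverse measure $\mu$ being $|dy|$; each singularity is the centre of a complex chart $\zeta$ in which the foliation is given by $|d\,\mathrm{Im}(\zeta^{k/2})|$ for some integer $k\ge 3$. Two of them are transverse if they have the same singularities, are given by $|dy|$ and $|dx|$ in common charts $(x,y)$ near every regular point, and by $|d\,\mathrm{Im}(\zeta^{k/2})|$ and $|d\,\mathrm{Re}(\zeta^{k/2})|$ in a common complex chart $\zeta$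 near every singularity. For a homeomorphism or covering map $p$ and $c>0$, write $p((\mathcal F,\mu))=(\mathcal G,c\,\nu)$ if the singularities of $\mathcal F$ are the points lying over those of $\mathcal G$, $p$ maps leaves locally to leaves, and $\mu(\gamma)=c\,\nu(p\circ\gamma)$ for arcs $\gamma$. A foliation is arational if it has no closed leaf, no cycle of leaves and no saddle connection, that is, no simple closed curve is contained in a (singular) leaf, and no simple arc in a (singular) leaf contains two singularities. Let $f:S_g\to S_g$ be a pseudo-Anosov homeomorphism with stretch factor $\lambda>1$, preserving a transverse pair $(\mathcal F_s,\mu_s)$, $(\mathcal F_u,\mu_u)$ of singular measured foliations, so that $$f((\mathcal F_u,\mu_u))=(\mathcal F_u,\lambda\mu_u)\quad\text{and}\quad f((\mathcal F_s,\mu_s))=(\mathcal F_s,\lambda^{-1}\mu_s),$$ and let the homeomorphism $\widetilde f:\mathcal L\to\mathcal L$ be a lift of $f$ under $q_g$, i.e. $q_g\circ\widetilde f=f\circ q_g$. Then there exists a transverse pair $(\widetilde{\mathcal F}_s,\widetilde\mu_s)$, $(\widetilde{\mathcal F}_u,\widetilde\mu_u)$ of singular measured foliations on $\mathcal L$ such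 that both are arational, both have a countably infinite set of singularities, which is closed and all of whose points are isolated, and (i) $q_g((\widetilde{\mathcal F}_s,\widetilde\mu_s))=(\mathcal F_s,\mu_s)$ and $q_g((\widetilde{\mathcal F}_u,\widetilde\mu_u))=(\mathcal F_u,\mu_u)$; (ii) $\widetilde f((\widetilde{\mathcal F}_u,\widetilde\mu_u))=(\widetilde{\mathcal F}_u,\lambda\widetilde\mu_u)$ and $\widetilde f((\widetilde{\mathcal F}_s,\widetilde\mu_s))=(\widetilde{\mathcal F}_s,\lambda^{-1}\widetilde\mu_s)$. -/

import Mathlib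

open Topology

noncomputable section

/-! ## The ladder surface, the handle shift and the cyclic cover -/

/-- Jacob's ladder surface as a subset of `ℝ³`: the smooth surface
`z² = (4 - y²) (y² + sin² (π x) - 1/4)`.  The right-hand side is nonnegative exactly on the infinite
strip `|y| ≤ 2` with an oval hole removed around each point `(n, 0)`, `n ∈ ℤ`; the surface is the
double of that region, i.e. an infinite cylinder with one handle for each integer. It has two ends,
both of them accumulated by genus. -/
def ladderSet : Set (ℝ × ℝ × ℝ) :=
  {v | v.2.2 ^ 2 = (4 - v.2.1 ^ 2) * (v.2.1 ^ 2 + Real.sin (Real.pi * v.1) ^ 2 - 1 / 4)}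

/-- Jacob's ladder surface, with the topology induced from `ℝ³`. -/
abbrev Ladder : Type := ladderSet

theorem ladderSet_shift (m : ℤ) {v : ℝ × ℝ × ℝ} (hv : v ∈ ladderSet) :
    ((v.1 + m, v.2.1, v.2.2) : ℝ × ℝ × ℝ) ∈ ladderSet := by
  have h : Real.sin (Real.pi * (v.1 + m)) ^ 2 = Real.sin (Real.pi * v.1) ^ 2 := by
    have e : Real.pi * (v.1 + m) = Real.pi * v.1 + m * Real.pi := by ring
    rw [e, Real.sin_add_int_mul_pi, mul_pow, ← zpow_natCast, ← zpow_mul, mul_comm m, zpow_mul]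
    simp
  simp only [ladderSet, Set.mem_ofPred_eq] at hv ⊢
  rw [h]; exact hv

/-- The handle shift by `m` units, `(x, y, z) ↦ (x + m, y, z)`: it carries each handle of the ladder
to the handle `m` places further to the right. -/
def handleShift (m : ℤ) : Ladder ≃ₜ Ladder where
  toFun v := ⟨(v.1.1 + m, v.1.2.1, v.1.2.2), ladderSet_shift m v.2⟩
  invFun v := ⟨(v.1.1 + (-m : ℤ), v.1.2.1, v.1.2.2), ladderSet_shift (-m) v.2⟩
  left_inv v := by ext <;> simp
  right_inv v := by ext <;> simp
  continuous_toFun := by fun_prop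
  continuous_invFun := by fun_prop

/-- Two points of the ladder are equivalent when they differ by a power of the handle shift
`h_{g-1}` by `g - 1` units. -/
def shiftSetoid (g : ℕ) : Setoid Ladder where
  r v w := ∃ n : ℤ, (handleShift ((g : ℤ) - 1) ^ n) v = w
  iseqv :=
    { refl := fun v => ⟨0, by simp⟩
      symm := by
        rintro v w ⟨n, rfl⟩
        refine ⟨-n, ?_⟩
        rw [← Homeomorph.mul_apply, ← zpow_add]
        simp
      trans := by
        rintro u v w ⟨n, rfl⟩ ⟨m, rfl⟩
        refine ⟨m + n, ?_⟩
        rw [zpow_add, Homeomorph.mul_apply] }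

/-- The closed orientable surface `S_g` of genus `g` (for `g ≥ 2`), as the quotient of the ladder by
the infinite cyclic group generated by `h_{g-1}`, with the quotient topology.  It is the double of an
annulus with `g - 1` holes. -/
abbrev ClosedSurface (g : ℕ) : Type := Quotient (shiftSetoid g)

/-- The infinite cyclic cover `q_g : 𝓛 → S_g`. -/
def ladderCover (g : ℕ) : Ladder → ClosedSurface g := Quotient.mk (shiftSetoid g)

/-! ## Singular measured foliations -/

section Foliations

variable {X Y : Type*} [TopologicalSpace X] [TopologicalSpace Y]

/-- Two charts into the `(x, y)`-plane define the same horizontal leaves and the same transverse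
measure `|dy|` on their common domain: locally their `y`-coordinates agree up to sign and an additive
constant, i.e. the transition maps are locally of the form `(x, y) ↦ (h (x, y), c ± y)`. -/
def MeasuredCompatible (φ ψ : OpenPartialHomeomorph X (ℝ × ℝ)) : Prop :=
  ∀ x ∈ φ.source ∩ ψ.source, ∃ ε b : ℝ, (ε = 1 ∨ ε = -1) ∧
    ∀ᶠ x' in 𝓝 x, (φ x').2 = ε * (ψ x').2 + b

/-- `φ` is a local branch of `ζ ^ (k / 2)` on an open set that does not contain the centre `p` of
the complex chart `ζ`. -/
def IsProngBranch (ζ : OpenPartialHomeomorph X ℂ) (p : X) (k : ℕ)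
    (φ : OpenPartialHomeomorph X (ℝ × ℝ)) : Prop :=
  φ.source ⊆ ζ.source \ {p} ∧ ∀ x ∈ φ.source, (⟨(φ x).1, (φ x).2⟩ : ℂ) ^ 2 = ζ x ^ k

/-- A singular measured foliation `(𝓕, μ)` on a surface `X`: a set of singularities and, on its
complement, a maximal atlas of natural charts, in which the leaves are the horizontal lines and the
transverse measure `μ` of an arc is the total variation of `y` along it.  Each singularity is a
`k`-prong singularity with `k ≥ 3`: it is the centre of a complex chart `ζ` in which the leaves are
the level curves of `Im (ζ ^ (k / 2))` and the transverse measure is `|d Im (ζ ^ (k / 2))|`. -/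
structure SingularMeasuredFoliation (X : Type*) [TopologicalSpace X] where
  /-- the set of singularities -/
  sing : Set X
  /-- the natural charts -/
  charts : Set (OpenPartialHomeomorph X (ℝ × ℝ))
  source_subset : ∀ φ ∈ charts, φ.source ⊆ singᶜ
  exists_chart : ∀ x ∉ sing, ∃ φ ∈ charts, x ∈ φ.source
  compatible : ∀ φ ∈ charts, ∀ ψ ∈ charts, MeasuredCompatible φ ψ
  maximal : ∀ φ : OpenPartialHomeomorph X (ℝ × ℝ), φ.source ⊆ singᶜ →
    (∀ ψ ∈ charts, MeasuredCompatible φ ψ) → φ ∈ charts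
  exists_prong : ∀ p ∈ sing, ∃ k : ℕ, 3 ≤ k ∧ ∃ ζ : OpenPartialHomeomorph X ℂ,
    p ∈ ζ.source ∧ ζ p = 0 ∧ ∀ φ, IsProngBranch ζ p k φ → φ ∈ charts

namespace SingularMeasuredFoliation

/-- `(F, μ)` and `(G, ν)` are transverse: they have the same singularities; near every other point
there are coordinates `(x, y)` in which `F` is horizontal with measure `|dy|` and `G` is vertical with
measure `|dx|`; near each singularity there is a complex coordinate `ζ` in which the two are given by
the imaginary and the real part of `ζ ^ (k / 2)` for one and the same `k`. -/
structure Transverse (F G : SingularMeasuredFoliation X) : Prop where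
  sing_eq : F.sing = G.sing
  regular : ∀ x ∉ F.sing, ∃ φ ∈ F.charts, x ∈ φ.source ∧
    φ.transHomeomorph (Homeomorph.prodComm ℝ ℝ) ∈ G.charts
  singular : ∀ p ∈ F.sing, ∃ k : ℕ, 3 ≤ k ∧ ∃ ζ : OpenPartialHomeomorph X ℂ,
    p ∈ ζ.source ∧ ζ p = 0 ∧ ∀ φ, IsProngBranch ζ p k φ →
      φ ∈ F.charts ∧ φ.transHomeomorph (Homeomorph.prodComm ℝ ℝ) ∈ G.charts

/-- For a homeomorphism or a covering map `p : X → Y`, this is the relation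
`p ((F, μ)) = (G, c ν)`: the singularities of `F` are the points over those of `G`, `p` carries leaves
to leaves, and the transverse measure `μ` of an arc `γ` is `c ν (p γ)`.  In natural charts `y_F` of
`F` and `y_G` of `G` the last two say that locally `y_F = ± c (y_G ∘ p) + b`. -/
def HasImage (F : SingularMeasuredFoliation X) (p : X → Y) (c : ℝ)
    (G : SingularMeasuredFoliation Y) : Prop :=
  F.sing = p ⁻¹' G.sing ∧
  ∀ φ ∈ F.charts, ∀ ψ ∈ G.charts, ∀ x ∈ φ.source, p x ∈ ψ.source →
    ∃ ε b : ℝ, (ε = 1 ∨ ε = -1) ∧ ∀ᶠ x' in 𝓝 x, (φ x').2 = ε * (c * (ψ (p x')).2) + b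

/-- A path that runs inside one (possibly singular) leaf: near each time at which it is at a regular
point, it stays in the plaque through that point. -/
def IsLeafPath (F : SingularMeasuredFoliation X) (γ : C(unitInterval, X)) : Prop :=
  ∀ t, ∀ φ ∈ F.charts, γ t ∈ φ.source → ∀ᶠ s in 𝓝 t, (φ (γ s)).2 = (φ (γ t)).2

/-- A foliation is arational if it has no closed leaves, no cycles of leaves and no saddle
connections: a path in a (singular) leaf without self-intersections in `[0, 1)` is not closed up and
meets at most one singularity. -/
def IsArational (F : SingularMeasuredFoliation X) : Prop :=
  ∀ γ : C(unitInterval, X), F.IsLeafPath γ → Set.InjOn γ (Set.Ico 0 1) →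
    γ 0 ≠ γ 1 ∧ (γ ⁻¹' F.sing).Subsingleton

/-- The singularities form a countably infinite set without accumulation points: the set is closed,
and each singularity has a neighbourhood that contains no other one. -/
structure HasCountablyInfiniteIsolatedSing (F : SingularMeasuredFoliation X) : Prop where
  countable : F.sing.Countable
  infinite : F.sing.Infinite
  isolated : ∀ p ∈ F.sing, ∃ U ∈ 𝓝 p, U ∩ F.sing = {p}
  closed : IsClosed F.sing

end SingularMeasuredFoliation

/-- The homeomorphism `f` is pseudo-Anosov with stable foliation `(Fs, μs)`, unstable foliation
`(Fu, μu)` and stretch factor `lam`: the two foliations are transverse, `lam > 1`,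
`f ((Fu, μu)) = (Fu, lam μu)` and `f ((Fs, μs)) = (Fs, lam⁻¹ μs)`. -/
structure IsPseudoAnosov (f : X ≃ₜ X) (Fs Fu : SingularMeasuredFoliation X) (lam : ℝ) : Prop where
  one_lt : 1 < lam
  transverse : Fs.Transverse Fu
  unstable : Fu.HasImage f lam Fu
  stable : Fs.HasImage f lam⁻¹ Fs

end Foliations

end


/-!
The foliations on the ladder are the pullbacks of those on the surface. A segment contained in a
leaf is contracted by powers of `f̃` or `f̃⁻¹` and can be carried back into a compact fundamental
segment by a deck transformation. In a compact set short leaf segments are straight in one chart or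
lie in the star of one singularity, so they neither close up nor join two singularities: the
lifted foliations are arational.

Their singular set is invariant under the deck group, hence infinite once it is nonempty. If it were
empty, the ladder would carry a flat structure whose transition maps are translations composed with
reflections in the axes, and by cocompactness it would be complete: there would be a developing map
from the plane onto the ladder. The lift of a loop through the base point ends at a point `b`, and
the loop acts on the plane by `u ↦ b + A u` with `A² = 1`, so its square is a translation. The
logarithms of the coordinates around the holes pull back to functions on the plane which these
translations change by twice the winding numbers of the loop. Three translation vectors of the plane
have arbitrarily small nontrivial integer combinations, so a `3 × 3` matrix of winding numbers is
always singular; but it is unitriangular for three loops that run around one, two and three holes.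
-/

/-- Along the filter `l`, the function `u` is `± c v` up to an additive constant. All comparisons of
transverse measures in natural charts have this form. -/
def AffineAlong {X : Type*} (c : ℝ) (l : Filter X) (u v : X → ℝ) : Prop :=
  ∃ ε b : ℝ, (ε = 1 ∨ ε = -1) ∧ ∀ᶠ x in l, u x = ε * (c * v x) + b

namespace AffineAlong

variable {X Y : Type*} {c d : ℝ} {l : Filter X} {u v w : X → ℝ}

theorem symm (h : AffineAlong c l u v) (hc : c ≠ 0) : AffineAlong c⁻¹ l v u := by
  obtain ⟨ε, b, hε, h⟩ := h
  refine ⟨ε, -(ε * c⁻¹ * b), hε, h.mono fun x hx => ?_⟩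
  rw [hx]
  rcases hε with rfl | rfl <;> field_simp <;> ring

theorem trans (h : AffineAlong c l u v) (h' : AffineAlong d l v w) :
    AffineAlong (c * d) l u w := by
  obtain ⟨ε, b, hε, h⟩ := h
  obtain ⟨ε', b', hε', h'⟩ := h'
  refine ⟨ε * ε', ε * c * b' + b, ?_, (h.and h').mono fun x hx => ?_⟩
  · rcases hε with rfl | rfl <;> rcases hε' with rfl | rfl <;> simp
  · rw [hx.1, hx.2]; ring

theorem comp (h : AffineAlong c l u v) {l' : Filter Y} {g : Y → X} (hg : Filter.Tendsto g l' l) :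
    AffineAlong c l' (fun y => u (g y)) (fun y => v (g y)) := by
  obtain ⟨ε, b, hε, h⟩ := h
  exact ⟨ε, b, hε, hg.eventually h⟩

theorem congr_left (h : AffineAlong c l u v) {u' : X → ℝ} (hu : u =ᶠ[l] u') :
    AffineAlong c l u' v := by
  obtain ⟨ε, b, hε, h⟩ := h
  exact ⟨ε, b, hε, (h.and hu).mono fun x hx => hx.2 ▸ hx.1⟩

theorem eventually_eq_const [TopologicalSpace X] {x : X} (h : AffineAlong c (𝓝 x) u v)
    (hv : ∀ᶠ x' in 𝓝 x, v x' = v x) : ∀ᶠ x' in 𝓝 x, u x' = u x := by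
  obtain ⟨ε, b, -, h⟩ := h
  filter_upwards [h, hv] with x' hu' hv'
  rw [hu', hv', h.self_of_nhds]

end AffineAlong

section Charts

variable {X Y Z : Type*} [TopologicalSpace X] [TopologicalSpace Y] [TopologicalSpace Z]

theorem measuredCompatible_iff {φ ψ : OpenPartialHomeomorph X (ℝ × ℝ)} :
    MeasuredCompatible φ ψ ↔ ∀ x ∈ φ.source ∩ ψ.source,
      AffineAlong 1 (𝓝 x) (fun x' => (φ x').2) (fun x' => (ψ x').2) := by
  simp only [MeasuredCompatible, AffineAlong, one_mul]

theorem transHomeomorph_prodComm_prodComm (φ : OpenPartialHomeomorph X (ℝ × ℝ)) :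
    (φ.transHomeomorph (Homeomorph.prodComm ℝ ℝ)).transHomeomorph (Homeomorph.prodComm ℝ ℝ) =
      φ := by
  rw [OpenPartialHomeomorph.transHomeomorph_transHomeomorph]
  ext <;> simp

namespace IsProngBranch

variable {k : ℕ} {φ : OpenPartialHomeomorph X (ℝ × ℝ)}

theorem symm_trans {e : OpenPartialHomeomorph X Y} {ζ : OpenPartialHomeomorph Y ℂ} {p : X}
    (h : IsProngBranch (e.trans ζ) p k φ) (hp : p ∈ e.source) :
    IsProngBranch ζ (e p) k (e.symm.trans φ) := by
  refine ⟨fun y hy => ?_, fun y hy => ?_⟩ <;>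
  simp only [OpenPartialHomeomorph.trans_source, OpenPartialHomeomorph.symm_source,
    Set.mem_inter_iff, Set.mem_preimage] at hy
  · have hy' := h.1 hy.2
    simp only [OpenPartialHomeomorph.trans_source, Set.mem_sdiff, Set.mem_inter_iff,
      Set.mem_preimage, e.right_inv hy.1, Set.mem_singleton_iff] at hy'
    refine ⟨hy'.1.2, ?_⟩
    rintro rfl
    exact hy'.2 (e.left_inv hp)
  · simpa [e.right_inv hy.1] using h.2 _ hy.2

theorem source_subset_of_trans {e : OpenPartialHomeomorph X Y} {ζ : OpenPartialHomeomorph Y ℂ}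
    {p : X} (h : IsProngBranch (e.trans ζ) p k φ) : φ.source ⊆ e.source :=
  fun _ hx => (h.1 hx).1.1

theorem transHomeomorph_prodComm {ζ : OpenPartialHomeomorph X ℂ} {p : X} {r : ℂ ≃ₜ ℂ}
    (hr : ∀ z, r z ^ k = -(starRingEnd ℂ) (z ^ k))
    (h : IsProngBranch (ζ.transHomeomorph r) p k φ) :
    IsProngBranch ζ p k (φ.transHomeomorph (Homeomorph.prodComm ℝ ℝ)) := by
  refine ⟨h.1, fun x hx => ?_⟩
  have hφx : (⟨(φ x).1, (φ x).2⟩ : ℂ) ^ 2 = -(starRingEnd ℂ) (ζ x ^ k) := by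
    rw [h.2 x hx, ← hr]; rfl
  have hζx : ζ x ^ k = -(starRingEnd ℂ) ((⟨(φ x).1, (φ x).2⟩ : ℂ) ^ 2) := by
    rw [hφx, map_neg, Complex.conj_conj, neg_neg]
  rw [hζx]
  apply Complex.ext <;> simp [pow_two]

end IsProngBranch

namespace SingularMeasuredFoliation

variable {F G : SingularMeasuredFoliation X}

theorem affineAlong_charts {φ ψ : OpenPartialHomeomorph X (ℝ × ℝ)} (hφ : φ ∈ F.charts)
    (hψ : ψ ∈ F.charts) {x : X} (hxφ : x ∈ φ.source) (hxψ : x ∈ ψ.source) :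
    AffineAlong 1 (𝓝 x) (fun x' => (φ x').2) (fun x' => (ψ x').2) :=
  measuredCompatible_iff.1 (F.compatible φ hφ ψ hψ) x ⟨hxφ, hxψ⟩

theorem isClosed_sing (F : SingularMeasuredFoliation X) : IsClosed F.sing := by
  rw [← isOpen_compl_iff, isOpen_iff_mem_nhds]
  intro x hx
  obtain ⟨φ, hφ, hxφ⟩ := F.exists_chart x hx
  exact Filter.mem_of_superset (φ.open_source.mem_nhds hxφ) (F.source_subset φ hφ)

theorem Transverse.symm (h : F.Transverse G) : G.Transverse F where
  sing_eq := h.sing_eq.symm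
  regular := by
    intro x hx
    rw [← h.sing_eq] at hx
    obtain ⟨φ, hφF, hxφ, hφG⟩ := h.regular x hx
    exact ⟨_, hφG, hxφ, by rwa [transHomeomorph_prodComm_prodComm]⟩
  singular := by
    intro p hp
    rw [← h.sing_eq] at hp
    obtain ⟨k, hk, ζ, hpζ, hζp, hζ⟩ := h.singular p hp
    obtain ⟨ω, hω⟩ := IsAlgClosed.exists_pow_nat_eq (-1 : ℂ) (by omega : 0 < k)
    have hω0 : ω ≠ 0 := by
      rintro rfl
      simp [show k ≠ 0 by omega] at hω
    -- With `ω ^ k = -1`, the `k`-th power of `ω * conj z` has the square roots of `z ^ k` with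
    -- real and imaginary parts exchanged.
    let r : ℂ ≃ₜ ℂ := Complex.conjCLE.toHomeomorph.trans (Homeomorph.mulLeft₀ ω hω0)
    have hr (z : ℂ) : r z ^ k = -(starRingEnd ℂ) (z ^ k) := by
      change (ω * (starRingEnd ℂ) z) ^ k = _
      rw [mul_pow, hω, map_pow, neg_one_mul]
    have hr0 : r 0 = 0 := by
      change ω * (starRingEnd ℂ) 0 = 0
      rw [map_zero, mul_zero]
    refine ⟨k, hk, ζ.transHomeomorph r, hpζ, by simp [hζp, hr0], fun φ hφ => ?_⟩
    obtain ⟨hφF, hφG⟩ := hζ _ (hφ.transHomeomorph_prodComm hr)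
    exact ⟨by rwa [transHomeomorph_prodComm_prodComm] at hφG, hφF⟩

namespace HasImage

variable {G : SingularMeasuredFoliation Y} {c : ℝ}

theorem affineAlong {p : X → Y} (h : F.HasImage p c G)
    {φ : OpenPartialHomeomorph X (ℝ × ℝ)} {ψ : OpenPartialHomeomorph Y (ℝ × ℝ)}
    (hφ : φ ∈ F.charts) (hψ : ψ ∈ G.charts) {x : X} (hxφ : x ∈ φ.source) (hxψ : p x ∈ ψ.source) :
    AffineAlong c (𝓝 x) (fun x' => (φ x').2) (fun x' => (ψ (p x')).2) :=
  h.2 φ hφ ψ hψ x hxφ hxψ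

theorem mem_sing_iff {p : X → Y} (h : F.HasImage p c G) (x : X) : p x ∈ G.sing ↔ x ∈ F.sing := by
  rw [h.1]; rfl

theorem refl (F : SingularMeasuredFoliation X) : F.HasImage id 1 F :=
  ⟨rfl, fun _ hφ _ hψ _ hxφ hxψ => affineAlong_charts hφ hψ hxφ hxψ⟩

theorem comp {H : SingularMeasuredFoliation Z} {p : X → Y} {q : Y → Z} {d : ℝ}
    (h : F.HasImage p c G) (h' : G.HasImage q d H) (hp : Continuous p) :
    F.HasImage (q ∘ p) (c * d) H := by
  refine ⟨by rw [h.1, h'.1]; rfl, fun φ hφ ψ hψ x hxφ hxψ => ?_⟩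
  have hreg : p x ∉ G.sing := by
    rw [h.mem_sing_iff]; exact F.source_subset φ hφ hxφ
  obtain ⟨χ, hχ, hxχ⟩ := G.exists_chart _ hreg
  exact (h.affineAlong hφ hχ hxφ hxχ).trans
    ((h'.affineAlong hχ hψ hxχ hxψ).comp hp.continuousAt)

theorem symm {f : X ≃ₜ Y} (h : F.HasImage f c G) (hc : c ≠ 0) : G.HasImage f.symm c⁻¹ F := by
  refine ⟨by ext y; rw [Set.mem_preimage, ← h.mem_sing_iff, f.apply_symm_apply],
    fun φ hφ ψ hψ y hyφ hyψ => ?_⟩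
  have hcoord := h.affineAlong hψ hφ hyψ (by simpa using hyφ)
  simpa [AffineAlong] using (hcoord.comp f.symm.continuous.continuousAt).symm hc

theorem pow {e : X ≃ₜ X} (h : F.HasImage e c F) (n : ℕ) : F.HasImage ⇑(e ^ n) (c ^ n) F := by
  induction n with
  | zero =>
    rw [pow_zero, pow_zero]
    exact refl F
  | succ n ih =>
    rw [pow_succ, pow_succ']
    exact h.comp ih e.continuous

theorem of_semiconj {F' : SingularMeasuredFoliation X} {H K : SingularMeasuredFoliation Y}
    {q : X → Y} {f : Y → Y} {f' : X → X} (hF : F.HasImage q 1 H) (hF' : F'.HasImage q 1 K)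
    (h : H.HasImage f c K) (hq : Continuous q) (hf' : Continuous f')
    (hs : Function.Semiconj q f' f) : F.HasImage f' c F' := by
  refine ⟨by rw [hF.1, hF'.1, h.1]; ext x; simp [hs x], fun φ hφ ψ hψ x hxφ hxψ => ?_⟩
  have hreg : q x ∉ H.sing := by
    rw [hF.mem_sing_iff]; exact F.source_subset φ hφ hxφ
  obtain ⟨φ₀, hφ₀, hxφ₀⟩ := H.exists_chart _ hreg
  have hreg' : q (f' x) ∉ K.sing := by
    rw [hF'.mem_sing_iff]; exact F'.source_subset ψ hψ hxψ
  obtain ⟨ψ₀, hψ₀, hxψ₀⟩ := K.exists_chart _ hreg'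
  have hup := hF.affineAlong hφ hφ₀ hxφ hxφ₀
  have hmap := (h.affineAlong hφ₀ hψ₀ hxφ₀ (by rwa [← hs x])).comp hq.continuousAt
  have hdown := ((hF'.affineAlong hψ hψ₀ hxψ hxψ₀).symm one_ne_zero).comp hf'.continuousAt
  simp only [← hs.eq] at hmap
  have hall := (hup.trans hmap).trans hdown
  rw [one_mul, inv_one, mul_one] at hall
  exact hall

end HasImage

theorem IsLeafPath.comp_of_hasImage {G : SingularMeasuredFoliation Y} {γ : C(unitInterval, X)}
    (hγ : F.IsLeafPath γ) {c : ℝ} (hc : c ≠ 0) (g : C(X, Y)) (hg : F.HasImage g c G) :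
    G.IsLeafPath (g.comp γ) := by
  intro t ψ hψ htψ
  have hreg : γ t ∉ F.sing := by
    rw [← hg.mem_sing_iff]; exact G.source_subset ψ hψ htψ
  obtain ⟨φ, hφ, htφ⟩ := F.exists_chart _ hreg
  exact (((hg.affineAlong hφ hψ htφ htψ).symm hc).comp
    γ.continuous.continuousAt).eventually_eq_const (hγ t φ hφ htφ)

/-- The charts that are natural for the pull-back of `F` along `q`: off the preimage of the
singularities, their `y`-coordinate is locally `± y ∘ q + b` for the natural charts of `F`. -/
def IsPullbackChart (q : X → Y) (F : SingularMeasuredFoliation Y)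
    (φ : OpenPartialHomeomorph X (ℝ × ℝ)) : Prop :=
  φ.source ⊆ (q ⁻¹' F.sing)ᶜ ∧ ∀ ψ ∈ F.charts, ∀ x ∈ φ.source, q x ∈ ψ.source →
    AffineAlong 1 (𝓝 x) (fun x' => (φ x').2) (fun x' => (ψ (q x')).2)

namespace IsPullbackChart

variable {F : SingularMeasuredFoliation Y} {e : OpenPartialHomeomorph X Y}

theorem of_symm_trans_mem {φ : OpenPartialHomeomorph X (ℝ × ℝ)} (hφe : φ.source ⊆ e.source)
    (he : e.symm.trans φ ∈ F.charts) : IsPullbackChart e F φ := by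
  have hmem : ∀ x ∈ φ.source, e x ∈ (e.symm.trans φ).source := fun x hx => by
    simp [e.map_source (hφe hx), e.left_inv (hφe hx), hx]
  refine ⟨fun x hx => F.source_subset _ he (hmem x hx), fun ψ hψ x hx hxψ => ?_⟩
  refine ((affineAlong_charts he hψ (hmem x hx) hxψ).comp
    (e.continuousAt (hφe hx))).congr_left ?_
  filter_upwards [e.open_source.mem_nhds (hφe hx)] with x' hx'
  simp [e.left_inv hx']

theorem of_trans {ψ : OpenPartialHomeomorph Y (ℝ × ℝ)} (hψ : ψ ∈ F.charts) :
    IsPullbackChart e F (e.trans ψ) := by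
  refine ⟨fun x hx => ?_, fun ψ' hψ' x hx hxψ' => ?_⟩ <;>
  simp only [OpenPartialHomeomorph.trans_source, Set.mem_inter_iff, Set.mem_preimage] at hx
  · exact F.source_subset ψ hψ hx.2
  · exact (affineAlong_charts hψ hψ' hx.2 hxψ').comp (e.continuousAt hx.1)

end IsPullbackChart

/-- The pull-back of a singular measured foliation along a local homeomorphism. -/
def lift {q : X → Y} (hq : IsLocalHomeomorph q) (F : SingularMeasuredFoliation Y) :
    SingularMeasuredFoliation X where
  sing := q ⁻¹' F.sing
  charts := {φ | IsPullbackChart q F φ}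
  source_subset := fun _ hφ => hφ.1
  exists_chart := by
    intro x hx
    obtain ⟨ψ, hψ, hxψ⟩ := F.exists_chart (q x) hx
    obtain ⟨e, hxe, rfl⟩ := hq x
    exact ⟨e.trans ψ, .of_trans hψ, by simp [hxe, hxψ]⟩
  compatible := by
    intro φ hφ ψ hψ
    rw [measuredCompatible_iff]
    rintro x ⟨hxφ, hxψ⟩
    obtain ⟨χ, hχ, hxχ⟩ := F.exists_chart (q x) (hφ.1 hxφ)
    simpa using (hφ.2 χ hχ x hxφ hxχ).trans ((hψ.2 χ hχ x hxψ hxχ).symm one_ne_zero)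
  maximal := by
    intro φ hφ hcompat
    refine ⟨hφ, fun ψ hψ x hxφ hxψ => ?_⟩
    obtain ⟨e, hxe, rfl⟩ := hq x
    exact measuredCompatible_iff.1 (hcompat _ (.of_trans hψ)) x ⟨hxφ, by simp [hxe, hxψ]⟩
  exists_prong := by
    intro p hp
    obtain ⟨k, hk, ζ, hpζ, hζp, hζ⟩ := F.exists_prong (q p) hp
    obtain ⟨e, hpe, rfl⟩ := hq p
    exact ⟨k, hk, e.trans ζ, by simp [hpe, hpζ], by simp [hζp], fun φ hφ =>
      .of_symm_trans_mem hφ.source_subset_of_trans (hζ _ (hφ.symm_trans hpe))⟩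

theorem hasImage_lift {q : X → Y} (hq : IsLocalHomeomorph q) (F : SingularMeasuredFoliation Y) :
    (F.lift hq).HasImage q 1 F :=
  ⟨rfl, fun _ hφ ψ hψ x hxφ hxψ => hφ.2 ψ hψ x hxφ hxψ⟩

theorem HasImage.lift {q : X → Y} (hq : IsLocalHomeomorph q) {F G : SingularMeasuredFoliation Y}
    {f : Y → Y} {f' : X → X} {c : ℝ} (h : F.HasImage f c G) (hf' : Continuous f')
    (hs : Function.Semiconj q f' f) : (F.lift hq).HasImage f' c (G.lift hq) :=
  .of_semiconj (hasImage_lift hq F) (hasImage_lift hq G) h hq.continuous hf' hs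

theorem hasImage_lift_deck {q : X → Y} (hq : IsLocalHomeomorph q) (F : SingularMeasuredFoliation Y)
    {τ : X ≃ₜ X} (hτ : ∀ x, q (τ x) = q x) : (F.lift hq).HasImage τ 1 (F.lift hq) :=
  (HasImage.refl F).lift hq τ.continuous hτ

theorem Transverse.lift {q : X → Y} (hq : IsLocalHomeomorph q) {F G : SingularMeasuredFoliation Y}
    (h : F.Transverse G) : (F.lift hq).Transverse (G.lift hq) where
  sing_eq := congrArg (q ⁻¹' ·) h.sing_eq
  regular := by
    intro x hx
    obtain ⟨φ, hφF, hxφ, hφG⟩ := h.regular (q x) hx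
    obtain ⟨e, hxe, rfl⟩ := hq x
    refine ⟨e.trans φ, .of_trans hφF, by simp [hxe, hxφ], ?_⟩
    rw [OpenPartialHomeomorph.trans_transHomeomorph]
    exact .of_trans hφG
  singular := by
    intro p hp
    obtain ⟨k, hk, ζ, hpζ, hζp, hζ⟩ := h.singular (q p) hp
    obtain ⟨e, hpe, rfl⟩ := hq p
    refine ⟨k, hk, e.trans ζ, by simp [hpe, hpζ], by simp [hζp], fun φ hφ => ?_⟩
    obtain ⟨hF, hG⟩ := hζ _ (hφ.symm_trans hpe)
    exact ⟨.of_symm_trans_mem hφ.source_subset_of_trans hF,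
      .of_symm_trans_mem hφ.source_subset_of_trans hG⟩

end SingularMeasuredFoliation

end Charts

section ProngBranches

theorem exists_openPartialHomeomorph_sq_eq_pow {k : ℕ} (hk : k ≠ 0) {z₀ : ℂ} (hz₀ : z₀ ≠ 0) :
    ∃ e : OpenPartialHomeomorph ℂ ℂ, z₀ ∈ e.source ∧ ∀ z ∈ e.source, z ≠ 0 ∧ e z ^ 2 = z ^ k := by
  obtain ⟨w, hw⟩ := IsAlgClosed.exists_pow_nat_eq (z₀ ^ k) two_pos
  have hw₀ : w ≠ 0 := by
    rintro rfl
    exact pow_ne_zero k hz₀ (by simpa using hw.symm)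
  let branch : ℂ → ℂ := fun z => w * (z / z₀) ^ (k / 2 : ℂ)
  have hsq : ∀ z, branch z ^ 2 = z ^ k := fun z => by
    rw [mul_pow, hw, ← Complex.cpow_mul_nat, Nat.cast_ofNat, div_mul_cancel₀ _ two_ne_zero,
      Complex.cpow_natCast, div_pow, mul_div_cancel₀ _ (pow_ne_zero k hz₀)]
  have hderiv := (((hasStrictDerivAt_id z₀).div_const z₀).cpow_const (c := (k / 2 : ℂ))
    (by simp [hz₀])).const_mul w
  have hinv := hderiv.hasStrictFDerivAt_equiv (by simp [hw₀, hz₀, hk])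
  exact ⟨(hinv.toOpenPartialHomeomorph branch).restrOpen {0}ᶜ isOpen_compl_singleton,
    ⟨hinv.mem_toOpenPartialHomeomorph_source, hz₀⟩, fun z hz => ⟨hz.2, hsq z⟩⟩

variable {X : Type*} [TopologicalSpace X] {ζ : OpenPartialHomeomorph X ℂ} {p x : X} {k : ℕ}

theorem exists_isProngBranch (hk : k ≠ 0) (hζp : ζ p = 0) (hx : x ∈ ζ.source) (hx₀ : ζ x ≠ 0) :
    ∃ φ, IsProngBranch ζ p k φ ∧ x ∈ φ.source := by
  obtain ⟨e, hxe, he⟩ := exists_openPartialHomeomorph_sq_eq_pow hk hx₀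
  have hsource : ∀ {y}, y ∈ ((ζ.trans e).transHomeomorph
      Complex.equivRealProdCLM.toHomeomorph).source ↔ y ∈ ζ.source ∧ ζ y ∈ e.source := by simp
  refine ⟨(ζ.trans e).transHomeomorph Complex.equivRealProdCLM.toHomeomorph,
    ⟨fun y hy => ?_, fun y hy => (he _ (hsource.1 hy).2).2⟩, hsource.2 ⟨hx, hxe⟩⟩
  refine ⟨(hsource.1 hy).1, ?_⟩
  rintro rfl
  exact (he _ (hsource.1 hy).2).1 hζp

theorem chart_apply_ne_zero (hp : p ∈ ζ.source) (hζp : ζ p = 0) (hx : x ∈ ζ.source)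
    (hxp : x ≠ p) : ζ x ≠ 0 :=
  fun h => hxp (ζ.injOn hx hp (h.trans hζp.symm))

theorem IsProngBranch.norm_sub_re {φ : OpenPartialHomeomorph X (ℝ × ℝ)}
    (hφ : IsProngBranch ζ p k φ) (hx : x ∈ φ.source) :
    ‖ζ x ^ k‖ - (ζ x ^ k).re = 2 * (φ x).2 ^ 2 := by
  rw [← hφ.2 x hx, norm_pow, Complex.sq_norm, Complex.normSq_apply]
  simp only [pow_two, Complex.mul_re]
  ring

namespace SingularMeasuredFoliation

variable {F : SingularMeasuredFoliation X}

theorem notMem_sing_of_prong (hk : k ≠ 0) (hp : p ∈ ζ.source) (hζp : ζ p = 0)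
    (hζ : ∀ φ, IsProngBranch ζ p k φ → φ ∈ F.charts) (hx : x ∈ ζ.source) (hxp : x ≠ p) :
    x ∉ F.sing := by
  obtain ⟨φ, hφ, hxφ⟩ := exists_isProngBranch hk hζp hx (chart_apply_ne_zero hp hζp hx hxp)
  exact F.source_subset φ (hζ φ hφ) hxφ

theorem exists_nhds_inter_sing (F : SingularMeasuredFoliation X) (hp : p ∈ F.sing) :
    ∃ U ∈ 𝓝 p, U ∩ F.sing = {p} := by
  obtain ⟨k, hk, ζ, hpζ, hζp, hζ⟩ := F.exists_prong p hp
  refine ⟨ζ.source, ζ.open_source.mem_nhds hpζ, Set.Subset.antisymm ?_ ?_⟩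
  · rintro x ⟨hx, hx_sing⟩
    by_contra hxp
    exact notMem_sing_of_prong (by omega) hpζ hζp hζ hx hxp hx_sing
  · rintro _ rfl
    exact ⟨hpζ, hp⟩

theorem hasCountablyInfiniteIsolatedSing [SecondCountableTopology X]
    (F : SingularMeasuredFoliation X) (h : F.sing.Infinite) :
    F.HasCountablyInfiniteIsolatedSing where
  countable := by
    have : DiscreteTopology F.sing := by
      rw [discreteTopology_subtype_iff']
      intro p hp
      obtain ⟨U, hU, hUp⟩ := F.exists_nhds_inter_sing hp
      obtain ⟨V, hVU, hV, hpV⟩ := mem_nhds_iff.1 hU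
      refine ⟨V, hV, subset_antisymm ?_ (Set.singleton_subset_iff.2 ⟨hpV, hp⟩)⟩
      rw [← hUp]
      gcongr
    exact Set.countable_coe_iff.1 (TopologicalSpace.separableSpace_iff_countable.1 inferInstance)
  infinite := h
  isolated := fun _ hp => F.exists_nhds_inter_sing hp
  closed := F.isClosed_sing

end SingularMeasuredFoliation

end ProngBranches

section ClosedCurves

theorem not_injOn_Ico_of_eq {α δ : Type*} [ConditionallyCompleteLinearOrder α] [DenselyOrdered α]
    [TopologicalSpace α] [OrderTopology α] [LinearOrder δ] [DenselyOrdered δ] [TopologicalSpace δ]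
    [OrderClosedTopology δ] {a b : α} (hab : a < b) {f : α → δ} (hf : ContinuousOn f (Set.Icc a b))
    (h : f a = f b) : ¬ Set.InjOn f (Set.Ico a b) := by
  intro hinj
  obtain ⟨c, hac, hcb⟩ := exists_between hab
  have hleft := hf.mono (Set.Icc_subset_Icc_right hcb.le)
  have hright := hf.mono (Set.Icc_subset_Icc_left hac.le)
  have hne : f a ≠ f c := fun hc => hac.ne (hinj ⟨le_rfl, hab⟩ ⟨hac.le, hcb⟩ hc)
  obtain ⟨s, hs, t, ht, hst⟩ : ∃ s ∈ Set.Ioo a c, ∃ t ∈ Set.Ioo c b, f s = f t := by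
    rcases hne.lt_or_gt with hlt | hgt
    · obtain ⟨m, hm⟩ := exists_between hlt
      obtain ⟨s, hs, rfl⟩ := intermediate_value_Ioo hac.le hleft hm
      obtain ⟨t, ht, hts⟩ := intermediate_value_Ioo' hcb.le hright (h ▸ hm)
      exact ⟨s, hs, t, ht, hts.symm⟩
    · obtain ⟨m, hm⟩ := exists_between hgt
      obtain ⟨s, hs, rfl⟩ := intermediate_value_Ioo' hac.le hleft hm
      obtain ⟨t, ht, hts⟩ := intermediate_value_Ioo hcb.le hright (h ▸ hm)
      exact ⟨s, hs, t, ht, hts.symm⟩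
  exact (hs.2.trans ht.1).ne
    (hinj ⟨hs.1.le, hs.2.trans hcb⟩ ⟨(hac.trans ht.1).le, ht.2⟩ hst)

theorem eq_of_eventually_eq_of_ne_zero {T R : Type*} [TopologicalSpace T] [PreconnectedSpace T]
    [TopologicalSpace R] [T1Space R] [Zero R] {Q : T → R} (hQ : Continuous Q)
    (h : ∀ u, Q u ≠ 0 → ∀ᶠ s in 𝓝 u, Q s = Q u) (u v : T) : Q u = Q v := by
  by_cases hzero : ∀ u, Q u = 0
  · rw [hzero, hzero]
  obtain ⟨w, hw⟩ := not_forall.1 hzero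
  have hclopen : IsClopen (Q ⁻¹' {Q w}) := by
    refine ⟨isClosed_singleton.preimage hQ, isOpen_iff_mem_nhds.2 fun s (hs : Q s = Q w) => ?_⟩
    filter_upwards [h s (hs ▸ hw)] with s' hs'
    exact hs'.trans hs
  have hall := Set.eq_univ_iff_forall.1 (hclopen.eq_univ ⟨w, rfl⟩)
  exact (hall u).trans (hall v).symm

theorem exists_eq_mul_on_closure_of_pow_eq_pow {T : Type*} [TopologicalSpace T] {S : Set T}
    (hS : IsPreconnected S) {Z r : T → ℂ} {k : ℕ} (hk : k ≠ 0) (hZ : Continuous Z)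
    (hr : Continuous r) (h : ∀ t ∈ S, Z t ^ k = r t ^ k) (hr₀ : ∀ t ∈ S, r t ≠ 0) :
    ∃ ω : ℂ, ∀ t ∈ closure S, Z t = ω * r t := by
  have hroots : {z : ℂ | z ^ k = 1}.Finite :=
    (Polynomial.nthRoots k (1 : ℂ)).toFinset.finite_toSet.subset fun z hz => by
      simpa [Polynomial.mem_nthRoots (Nat.pos_of_ne_zero hk)] using hz
  obtain ⟨ω, -, hω⟩ := hS.eqOn_const_of_mapsTo hroots.isDiscrete
    (hZ.continuousOn.div hr.continuousOn hr₀)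
    (fun t ht => by simp [div_pow, h t ht, hr₀ t ht]) ⟨1, one_pow k⟩
  refine ⟨ω, Set.EqOn.closure (fun t ht => ?_) hZ (continuous_const.mul hr)⟩
  exact (div_eq_iff (hr₀ t ht)).1 (hω ht)

open ComplexOrder in
theorem eq_norm_of_norm_sub_re_eq_zero {w : ℂ} (h : ‖w‖ - w.re = 0) : w = (‖w‖ : ℂ) :=
  Complex.eq_coe_norm_of_nonneg (Complex.re_eq_norm.1 (sub_eq_zero.1 h).symm)

open ComplexOrder in
theorem neg_mem_slitPlane_of_norm_sub_re_ne_zero {w : ℂ} (h : ‖w‖ - w.re ≠ 0) :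
    -w ∈ Complex.slitPlane := by
  rw [Complex.mem_slitPlane_iff_not_le_zero, neg_nonpos, ← Complex.re_eq_norm]
  exact fun hw => h (sub_eq_zero.2 hw.symm)

theorem eq_of_norm_sub_re_eq_of_im_eq {w z : ℂ} (h : ‖w‖ - w.re = ‖z‖ - z.re)
    (hz : ‖z‖ - z.re ≠ 0) (him : w.im = z.im) : w = z := by
  have hparabola : ∀ v : ℂ, (‖v‖ - v.re) * (‖v‖ - v.re + 2 * v.re) = v.im ^ 2 := fun v => by
    have := Complex.sq_norm v
    rw [Complex.normSq_apply] at this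
    linear_combination this
  have hw := hparabola w
  rw [h, him, ← hparabola z] at hw
  exact Complex.ext (by linarith [mul_left_cancel₀ hz hw]) him

variable {Z : unitInterval → ℂ} {k : ℕ}

theorem exists_eq_mul_norm (hZ : Continuous Z) (hk : k ≠ 0)
    (hpow : ∀ t, Z t ^ k = (‖Z t‖ : ℂ) ^ k) (h : Z 0 = Z 1) (hinj : Set.InjOn Z (Set.Ico 0 1)) :
    ∃ ω : ℂ, ∀ t, Z t = ω * ‖Z t‖ := by
  have hbranch : ∀ a b : unitInterval, a < b → (∀ t ∈ Set.Ioo a b, Z t ≠ 0) →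
      ∃ ω : ℂ, ∀ t ∈ Set.Icc a b, Z t = ω * ‖Z t‖ := fun a b hab hne => by
    rw [← closure_Ioo hab.ne]
    exact exists_eq_mul_on_closure_of_pow_eq_pow isPreconnected_Ioo hk hZ (by fun_prop)
      (fun t _ => hpow t) (fun t ht => by simpa using hne t ht)
  by_cases hzero : ∀ t ∈ Set.Ioo 0 1, Z t ≠ 0
  · obtain ⟨ω, hω⟩ := hbranch 0 1 zero_lt_one hzero
    exact ⟨ω, fun t => hω t t.2⟩
  push Not at hzero
  obtain ⟨t₀, ht₀, hZt₀⟩ := hzero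
  have hunique : ∀ t ∈ Set.Ico 0 1, Z t = 0 → t = t₀ := fun t ht hZt =>
    hinj ht ⟨ht₀.1.le, ht₀.2⟩ (hZt.trans hZt₀.symm)
  obtain ⟨ω, hω⟩ := hbranch 0 t₀ ht₀.1 fun t ht hZt =>
    ht.2.ne (hunique t ⟨ht.1.le, ht.2.trans ht₀.2⟩ hZt)
  obtain ⟨ω', hω'⟩ := hbranch t₀ 1 ht₀.2 fun t ht hZt =>
    ht.1.ne' (hunique t ⟨ht₀.1.le.trans ht.1.le, ht.2⟩ hZt)
  have hZ0 : (‖Z 0‖ : ℂ) ≠ 0 := by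
    simpa using fun h0 => ht₀.1.ne (hunique 0 ⟨le_rfl, zero_lt_one⟩ h0)
  have hωω' : ω = ω' := by
    refine mul_right_cancel₀ hZ0 ?_
    rw [← hω 0 ⟨le_rfl, ht₀.1.le⟩, h, ← hω' 1 ⟨ht₀.2.le, le_rfl⟩]
  refine ⟨ω, fun t => ?_⟩
  rcases le_total t t₀ with ht | ht
  · exact hω t ⟨t.2.1, ht⟩
  · exact hωω' ▸ hω' t ⟨ht, t.2.2⟩

theorem exists_eq_mul_neg_pow_cpow (hZ : Continuous Z) (hk : k ≠ 0)
    (hslit : ∀ t, -(Z t ^ k) ∈ Complex.slitPlane) :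
    ∃ ω : ℂ, ∀ t, Z t = ω * (-(Z t ^ k)) ^ ((k : ℂ)⁻¹) := by
  obtain ⟨ω₀, hω₀⟩ := IsAlgClosed.exists_pow_nat_eq (-1 : ℂ) (Nat.pos_of_ne_zero hk)
  have hω₀_ne : ω₀ ≠ 0 := by
    rintro rfl
    simp [hk] at hω₀
  have hroot : Continuous fun t => (-(Z t ^ k)) ^ ((k : ℂ)⁻¹) :=
    (hZ.pow k).neg.cpow continuous_const hslit
  obtain ⟨ω, hω⟩ := exists_eq_mul_on_closure_of_pow_eq_pow isPreconnected_univ hk hZ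
    (hroot.const_mul ω₀)
    (fun t _ => by rw [mul_pow, hω₀, Complex.cpow_nat_inv_pow _ hk]; ring)
    (fun t _ => mul_ne_zero hω₀_ne fun h0 =>
      Complex.slitPlane_ne_zero (hslit t) ((Complex.cpow_eq_zero_iff _ _).1 h0).1)
  exact ⟨ω * ω₀, fun t => by rw [mul_assoc]; exact hω t (subset_closure trivial)⟩

/- `‖Z ^ k‖ - Re (Z ^ k) = 2 (Im (Z ^ (k / 2))) ^ 2`, so `hlevel` says that the curve runs in a
level set of `|Im (Z ^ (k / 2))|`: a star of rays at level zero, and otherwise a union of arcs each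
of which `Z ^ k` maps injectively onto a parabola. -/
theorem not_injOn_Ico_of_prong (hZ : Continuous Z) (hk : k ≠ 0)
    (hlevel : ∀ u v, ‖Z u ^ k‖ - (Z u ^ k).re = ‖Z v ^ k‖ - (Z v ^ k).re) (h : Z 0 = Z 1) :
    ¬ Set.InjOn Z (Set.Ico 0 1) := by
  intro hinj
  by_cases hq : ‖Z 0 ^ k‖ - (Z 0 ^ k).re = 0
  · have hpow : ∀ t, Z t ^ k = (‖Z t‖ : ℂ) ^ k := fun t => by
      rw [← Complex.ofReal_pow, ← norm_pow]
      exact eq_norm_of_norm_sub_re_eq_zero ((hlevel t 0).trans hq)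
    obtain ⟨ω, hω⟩ := exists_eq_mul_norm hZ hk hpow h hinj
    refine not_injOn_Ico_of_eq zero_lt_one hZ.norm.continuousOn (congrArg norm h)
      fun s hs t ht hst => hinj hs ht ?_
    rw [hω s, hω t, hst]
  · have hq' : ∀ t, ‖Z t ^ k‖ - (Z t ^ k).re ≠ 0 := fun t => hlevel t 0 ▸ hq
    obtain ⟨ω, hω⟩ := exists_eq_mul_neg_pow_cpow hZ hk fun t =>
      neg_mem_slitPlane_of_norm_sub_re_ne_zero (hq' t)
    have him : Continuous fun t => (Z t ^ k).im := Complex.continuous_im.comp (hZ.pow k)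
    refine not_injOn_Ico_of_eq zero_lt_one him.continuousOn (by rw [h])
      fun s hs t ht hst => hinj hs ht ?_
    rw [hω s, hω t, eq_of_norm_sub_re_eq_of_im_eq (hlevel s t) (hq' t) hst]

end ClosedCurves

section LeafPaths

variable {X : Type*} [TopologicalSpace X] {γ : C(unitInterval, X)} {a : unitInterval}

/-- The part of a path from time `a` on, reparametrised affinely to the unit interval. -/
def pathTail (γ : C(unitInterval, X)) (a : unitInterval) : C(unitInterval, X) :=
  γ.comp ⟨fun s => unitInterval.symm (unitInterval.symm s * unitInterval.symm a), by fun_prop⟩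

theorem pathTail_zero : pathTail γ a 0 = γ a := by simp [pathTail]

theorem pathTail_one : pathTail γ a 1 = γ 1 := by simp [pathTail]

theorem injOn_pathTail (hinj : Set.InjOn γ (Set.Ico 0 1)) (ha : a < 1) :
    Set.InjOn (pathTail γ a) (Set.Ico 0 1) := by
  have hsymm_a : unitInterval.symm a ≠ 0 := fun h => ha.ne (unitInterval.symm_eq_zero.1 h)
  have hmem : ∀ s ∈ Set.Ico (0 : unitInterval) 1,
      unitInterval.symm (unitInterval.symm s * unitInterval.symm a) ∈ Set.Ico 0 1 := fun s hs =>
    ⟨unitInterval.nonneg', unitInterval.lt_one_iff_ne_one.2 fun h =>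
      mul_ne_zero (fun h' => hs.2.ne (unitInterval.symm_eq_zero.1 h')) hsymm_a
        (unitInterval.symm_eq_one.1 h)⟩
  intro s hs t ht hst
  have hsymm := unitInterval.symm_inj.1 (hinj (hmem s hs) (hmem t ht) hst)
  exact unitInterval.symm_inj.1 (mul_right_cancel₀ hsymm_a hsymm)

namespace SingularMeasuredFoliation

variable {F : SingularMeasuredFoliation X}

theorem IsLeafPath.pathTail (hγ : F.IsLeafPath γ) (a : unitInterval) :
    F.IsLeafPath (pathTail γ a) :=
  fun _ φ hφ ht => (ContinuousMap.continuous _).continuousAt.eventually (hγ _ φ hφ ht)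

theorem IsLeafPath.snd_chart_eq (hγ : F.IsLeafPath γ) {φ : OpenPartialHomeomorph X (ℝ × ℝ)}
    (hφ : φ ∈ F.charts) (h : ∀ t, γ t ∈ φ.source) (s t : unitInterval) :
    (φ (γ s)).2 = (φ (γ t)).2 :=
  (IsLocallyConstant.iff_eventually_eq fun t => (φ (γ t)).2).2
    (fun t => hγ t φ hφ (h t)) |>.apply_eq_of_preconnectedSpace s t

theorem IsLeafPath.ne_of_chart (hγ : F.IsLeafPath γ) (hinj : Set.InjOn γ (Set.Ico 0 1))
    {φ : OpenPartialHomeomorph X (ℝ × ℝ)} (hφ : φ ∈ F.charts) (h : ∀ t, γ t ∈ φ.source) :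
    γ 0 ≠ γ 1 := by
  intro hclosed
  have hcont : Continuous fun t => φ (γ t) := φ.continuousOn.comp_continuous γ.continuous h
  refine not_injOn_Ico_of_eq zero_lt_one hcont.fst.continuousOn (by rw [hclosed])
    fun s hs t ht hst => hinj hs ht ?_
  exact φ.injOn (h s) (h t) (Prod.ext hst (hγ.snd_chart_eq hφ h s t))

variable {ζ : OpenPartialHomeomorph X ℂ} {p : X} {k : ℕ}

theorem IsLeafPath.norm_sub_re_eq (hγ : F.IsLeafPath γ) (hk : k ≠ 0) (hζp : ζ p = 0)
    (hζ : ∀ φ, IsProngBranch ζ p k φ → φ ∈ F.charts) {S : Set unitInterval}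
    (hS : IsPreconnected S) (h : ∀ t ∈ S, γ t ∈ ζ.source) {u v : unitInterval} (hu : u ∈ S)
    (hv : v ∈ S) :
    ‖ζ (γ u) ^ k‖ - (ζ (γ u) ^ k).re = ‖ζ (γ v) ^ k‖ - (ζ (γ v) ^ k).re := by
  have := isPreconnected_iff_preconnectedSpace.1 hS
  have hγS : Continuous fun t : S => γ t := γ.continuous.comp continuous_subtype_val
  have hcont : Continuous fun t : S => ζ (γ t) ^ k :=
    (ζ.continuousOn.comp_continuous hγS fun t => h t t.2).pow k
  refine eq_of_eventually_eq_of_ne_zero (Q := fun t : S => ‖ζ (γ t) ^ k‖ - (ζ (γ t) ^ k).re)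
    (hcont.norm.sub (Complex.continuous_re.comp hcont)) (fun t ht => ?_) ⟨u, hu⟩ ⟨v, hv⟩
  have ht₀ : ζ (γ t) ≠ 0 := fun h0 => ht (by simp [h0, hk])
  obtain ⟨φ, hφ, htφ⟩ := exists_isProngBranch hk hζp (h t t.2) ht₀
  filter_upwards [continuous_subtype_val.continuousAt.eventually (hγ t φ (hζ φ hφ) htφ),
    hγS.continuousAt.preimage_mem_nhds (φ.open_source.mem_nhds htφ)] with s hs hsφ
  rw [hφ.norm_sub_re hsφ, hφ.norm_sub_re htφ, hs]

theorem IsLeafPath.ne_of_prong (hγ : F.IsLeafPath γ) (hinj : Set.InjOn γ (Set.Ico 0 1))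
    (hk : k ≠ 0) (hζp : ζ p = 0) (hζ : ∀ φ, IsProngBranch ζ p k φ → φ ∈ F.charts)
    (h : ∀ t, γ t ∈ ζ.source) : γ 0 ≠ γ 1 := fun hclosed =>
  not_injOn_Ico_of_prong (ζ.continuousOn.comp_continuous γ.continuous h) hk
    (fun u v => hγ.norm_sub_re_eq hk hζp hζ isPreconnected_univ (fun t _ => h t)
      (Set.mem_univ u) (Set.mem_univ v))
    (congrArg ζ hclosed) (fun s hs t ht hst => hinj hs ht (ζ.injOn (h s) (h t) hst))

theorem exists_nhds_leafPath_ne (F : SingularMeasuredFoliation X) (q : X) :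
    ∃ V ∈ 𝓝 q, (V ∩ F.sing).Subsingleton ∧ ∀ γ : C(unitInterval, X), F.IsLeafPath γ →
      Set.InjOn γ (Set.Ico 0 1) → (∀ t, γ t ∈ V) → γ 0 ≠ γ 1 := by
  by_cases hq : q ∈ F.sing
  · obtain ⟨k, hk, ζ, hqζ, hζq, hζ⟩ := F.exists_prong q hq
    have hk₀ : k ≠ 0 := by omega
    refine ⟨ζ.source, ζ.open_source.mem_nhds hqζ, ?_, fun γ hγ hinj h =>
      hγ.ne_of_prong hinj hk₀ hζq hζ h⟩
    refine Set.subsingleton_singleton.anti (t := {q}) fun x ⟨hx, hx_sing⟩ => ?_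
    exact of_not_not fun hxq => notMem_sing_of_prong hk₀ hqζ hζq hζ hx hxq hx_sing
  · obtain ⟨φ, hφ, hqφ⟩ := F.exists_chart q hq
    refine ⟨φ.source, φ.open_source.mem_nhds hqφ, fun x hx => ?_, fun γ hγ hinj h =>
      hγ.ne_of_chart hinj hφ h⟩
    exact absurd hx.2 (F.source_subset φ hφ hx.1)

theorem exists_nhds_leafPath_ne_and_subsingleton (F : SingularMeasuredFoliation X) (q : X) :
    ∃ V ∈ 𝓝 q, ∀ γ : C(unitInterval, X), F.IsLeafPath γ → Set.InjOn γ (Set.Ico 0 1) →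
      (∀ t, γ t ∈ V) → γ 0 ≠ γ 1 ∧ (γ ⁻¹' F.sing).Subsingleton := by
  obtain ⟨V, hV, hVsing, hVne⟩ := F.exists_nhds_leafPath_ne q
  refine ⟨V, hV, fun γ hγ hinj hγV => ⟨hVne γ hγ hinj hγV, ?_⟩⟩
  have hnot_lt : ∀ s t, γ s ∈ F.sing → γ t ∈ F.sing → ¬ s < t := by
    intro s t hs ht hst
    have heq : γ s = γ t := hVsing ⟨hγV s, hs⟩ ⟨hγV t, ht⟩
    have hs1 : s < 1 := hst.trans_le unitInterval.le_one'
    rcases (unitInterval.le_one' (t := t)).lt_or_eq with ht1 | rfl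
    · exact hst.ne (hinj ⟨unitInterval.nonneg', hs1⟩ ⟨unitInterval.nonneg', ht1⟩ heq)
    · refine hVne _ (hγ.pathTail s) (injOn_pathTail hinj hs1) (fun u => hγV _) ?_
      rwa [pathTail_zero, pathTail_one]
  exact fun s hs t ht =>
    le_antisymm (not_lt.1 (hnot_lt t s ht hs)) (not_lt.1 (hnot_lt s t hs ht))

end SingularMeasuredFoliation

end LeafPaths

section StraightSegments

variable {X : Type*} [TopologicalSpace X]

namespace SingularMeasuredFoliation

/-- A common chart of two foliations: `F` is horizontal and `G` is vertical. -/
def IsPairChart (F G : SingularMeasuredFoliation X) (φ : OpenPartialHomeomorph X (ℝ × ℝ)) : Prop :=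
  φ ∈ F.charts ∧ φ.transHomeomorph (Homeomorph.prodComm ℝ ℝ) ∈ G.charts

/-- The map `σ` runs on `(a, b)` through a leaf of `F` at constant speed `c` with respect to the
transverse measure of `G`. -/
structure IsStraight (F G : SingularMeasuredFoliation X) (c : ℝ) (σ : ℝ → X) (a b : ℝ) : Prop where
  continuousOn : ContinuousOn σ (Set.Ioo a b)
  notMem_sing : ∀ u ∈ Set.Ioo a b, σ u ∉ F.sing
  horizontal : ∀ u ∈ Set.Ioo a b, ∀ φ, IsPairChart F G φ → σ u ∈ φ.source →
    AffineAlong c (𝓝 u) (fun u' => (φ (σ u')).1) id ∧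
      ∀ᶠ u' in 𝓝 u, (φ (σ u')).2 = (φ (σ u)).2

variable {F G : SingularMeasuredFoliation X} {c a b : ℝ} {σ : ℝ → X}

theorem IsPairChart.affineAlong_fst {φ ψ : OpenPartialHomeomorph X (ℝ × ℝ)}
    (hφ : IsPairChart F G φ) (hψ : IsPairChart F G ψ) {x : X} (hxφ : x ∈ φ.source)
    (hxψ : x ∈ ψ.source) : AffineAlong 1 (𝓝 x) (fun x' => (φ x').1) (fun x' => (ψ x').1) :=
  affineAlong_charts hφ.2 hψ.2 hxφ hxψ

theorem IsStraight.of_exists_chart (hσ : ContinuousOn σ (Set.Ioo a b))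
    (h : ∀ u ∈ Set.Ioo a b, ∃ φ, IsPairChart F G φ ∧ σ u ∈ φ.source ∧
      AffineAlong c (𝓝 u) (fun u' => (φ (σ u')).1) id ∧
      ∀ᶠ u' in 𝓝 u, (φ (σ u')).2 = (φ (σ u)).2) : IsStraight F G c σ a b where
  continuousOn := hσ
  notMem_sing := fun u hu => by
    obtain ⟨φ, hφ, huφ, -⟩ := h u hu
    exact F.source_subset φ hφ.1 huφ
  horizontal := fun u hu ψ hψ huψ => by
    obtain ⟨φ, hφ, huφ, hfst, hsnd⟩ := h u hu
    have hσu : ContinuousAt σ u := hσ.continuousAt (Ioo_mem_nhds hu.1 hu.2)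
    refine ⟨by simpa using ((hψ.affineAlong_fst hφ huψ huφ).comp hσu).trans hfst, ?_⟩
    exact ((affineAlong_charts hψ.1 hφ.1 huψ huφ).comp hσu).eventually_eq_const hsnd

theorem IsStraight.image {d c' : ℝ} (h : IsStraight F G c σ a b) {g : X → X} (hg : Continuous g)
    (hF : F.HasImage g d F) (hd : d ≠ 0) (hG : G.HasImage g c' G) (hc' : c' ≠ 0)
    (hFG : F.Transverse G) : IsStraight F G (c'⁻¹ * c) (g ∘ σ) a b := by
  refine .of_exists_chart (hg.comp_continuousOn h.continuousOn) fun u hu => ?_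
  obtain ⟨φ, hφF, huφ, hφG⟩ := hFG.regular _ (h.notMem_sing u hu)
  obtain ⟨ψ, hψF, huψ, hψG⟩ := hFG.regular (g (σ u)) (by
    rw [hF.mem_sing_iff]; exact h.notMem_sing u hu)
  obtain ⟨hfst, hsnd⟩ := h.horizontal u hu φ ⟨hφF, hφG⟩ huφ
  have hσu : ContinuousAt σ u := h.continuousOn.continuousAt (Ioo_mem_nhds hu.1 hu.2)
  exact ⟨ψ, ⟨hψF, hψG⟩, huψ, (((hG.affineAlong hφG hψG huφ huψ).symm hc').comp hσu).trans hfst,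
    (((hF.affineAlong hφF hψF huφ huψ).symm hd).comp hσu).eventually_eq_const hsnd⟩

/-- A gauge at `q`: a function on a neighbourhood of `q` that is in suitable common charts of the
two foliations the squared distance from some point, and whose sublevel sets shrink to `q`. -/
structure IsGauge (F G : SingularMeasuredFoliation X) (q : X) (O : Set X) (M : X → ℝ) : Prop where
  isOpen : IsOpen O
  mem : q ∈ O
  continuousAt : ContinuousAt M q
  apply_self : M q = 0
  basis : ∀ V ∈ 𝓝 q, ∃ ρ > 0, IsClosed {x ∈ O | M x ≤ ρ} ∧ {x ∈ O | M x ≤ ρ} ⊆ V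
  chart : ∀ x ∈ O, x ∉ F.sing → ∃ φ, IsPairChart F G φ ∧ x ∈ φ.source ∧ ∃ a b : ℝ,
    ∀ᶠ x' in 𝓝 x, M x' = ((φ x').1 - a) ^ 2 + ((φ x').2 - b) ^ 2

theorem exists_isClosed_sublevel_subset [T2Space X] {E : Type*} [PseudoMetricSpace E]
    [ProperSpace E] (e : OpenPartialHomeomorph X E) {q : X} (hq : q ∈ e.source) {m : E → ℝ}
    (hm : Continuous m)
    (hball : ∀ r > 0, ∃ ρ > 0, ∀ v, m v ≤ ρ → v ∈ Metric.closedBall (e q) r) {V : Set X}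
    (hV : V ∈ 𝓝 q) :
    ∃ ρ > 0, IsClosed {x ∈ e.source | m (e x) ≤ ρ} ∧ {x ∈ e.source | m (e x) ≤ ρ} ⊆ V := by
  have hV_target : e.target ∩ e.symm ⁻¹' V ∈ 𝓝 (e q) :=
    Filter.inter_mem (e.open_target.mem_nhds (e.map_source hq)) (e.tendsto_symm hq hV)
  obtain ⟨r, hr, hrV⟩ := Metric.nhds_basis_closedBall.mem_iff.1 hV_target
  obtain ⟨ρ, hρ, hρr⟩ := hball r hr
  have hsub : {v | m v ≤ ρ} ⊆ e.target ∩ e.symm ⁻¹' V := fun v hv => hrV (hρr v hv)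
  have himage : {x ∈ e.source | m (e x) ≤ ρ} = e.symm '' {v | m v ≤ ρ} := by
    ext x
    constructor
    · rintro ⟨hx, hxρ⟩
      exact ⟨e x, hxρ, e.left_inv hx⟩
    · rintro ⟨v, hv, rfl⟩
      refine ⟨e.map_target (hsub hv).1, ?_⟩
      rwa [e.right_inv (hsub hv).1]
  refine ⟨ρ, hρ, ?_⟩
  rw [himage]
  refine ⟨IsCompact.isClosed (IsCompact.image_of_continuousOn ?_ ?_), ?_⟩
  · exact (isCompact_closedBall (e q) r).of_isClosed_subset (isClosed_le hm continuous_const) hρr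
  · exact e.continuousOn_symm.mono fun v hv => (hsub hv).1
  · exact Set.image_subset_iff.2 fun v hv => (hsub hv).2

theorem isGauge_norm_pow [T2Space X] {q : X} (hq : q ∈ F.sing) {k : ℕ} (hk : k ≠ 0)
    {ζ : OpenPartialHomeomorph X ℂ} (hqζ : q ∈ ζ.source) (hζq : ζ q = 0)
    (hζ : ∀ φ, IsProngBranch ζ q k φ → IsPairChart F G φ) :
    IsGauge F G q ζ.source fun x => ‖ζ x‖ ^ k where
  isOpen := ζ.open_source
  mem := hqζ
  continuousAt := (ζ.continuousAt hqζ).norm.pow k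
  apply_self := by simp [hζq, hk]
  basis := fun V hV => by
    refine exists_isClosed_sublevel_subset ζ hqζ (continuous_norm.pow k) (fun r hr => ?_) hV
    refine ⟨r ^ k, by positivity, fun v hv => ?_⟩
    rw [hζq, mem_closedBall_zero_iff]
    exact le_of_pow_le_pow_left₀ hk hr.le hv
  chart := fun x hx hx_sing => by
    have hxq : x ≠ q := fun h => hx_sing (h ▸ hq)
    obtain ⟨φ, hφ, hxφ⟩ := exists_isProngBranch hk hζq hx (chart_apply_ne_zero hqζ hζq hx hxq)
    refine ⟨φ, hζ φ hφ, hxφ, 0, 0, ?_⟩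
    filter_upwards [φ.open_source.mem_nhds hxφ] with x' hx'
    rw [← norm_pow, ← hφ.2 x' hx', norm_pow, Complex.sq_norm, Complex.normSq_apply]
    ring

theorem isGauge_sq_dist [T2Space X] {q : X} {φ : OpenPartialHomeomorph X (ℝ × ℝ)}
    (hφ : IsPairChart F G φ) (hqφ : q ∈ φ.source) :
    IsGauge F G q φ.source fun x => ((φ x).1 - (φ q).1) ^ 2 + ((φ x).2 - (φ q).2) ^ 2 where
  isOpen := φ.open_source
  mem := hqφ
  continuousAt := by
    have hcont := φ.continuousAt hqφ
    exact ((hcont.fst.sub continuousAt_const).pow 2).add ((hcont.snd.sub continuousAt_const).pow 2)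
  apply_self := by simp
  basis := fun V hV => by
    refine exists_isClosed_sublevel_subset φ hqφ
      (m := fun v => (v.1 - (φ q).1) ^ 2 + (v.2 - (φ q).2) ^ 2) (by fun_prop) (fun r hr => ?_) hV
    refine ⟨r ^ 2, by positivity, fun v hv => ?_⟩
    rw [Metric.mem_closedBall, Prod.dist_eq, max_le_iff, Real.dist_eq, Real.dist_eq]
    exact ⟨abs_le_of_sq_le_sq (by linarith [sq_nonneg (v.2 - (φ q).2)]) hr.le,
      abs_le_of_sq_le_sq (by linarith [sq_nonneg (v.1 - (φ q).1)]) hr.le⟩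
  chart := fun x hx _ => ⟨φ, hφ, hx, _, _, Filter.Eventually.of_forall fun _ => rfl⟩

theorem Transverse.exists_isGauge [T2Space X] (h : F.Transverse G) (q : X) :
    ∃ O M, IsGauge F G q O M := by
  by_cases hq : q ∈ F.sing
  · obtain ⟨k, hk, ζ, hqζ, hζq, hζ⟩ := h.singular q hq
    exact ⟨_, _, isGauge_norm_pow hq (by omega) hqζ hζq hζ⟩
  · obtain ⟨φ, hφF, hqφ, hφG⟩ := h.regular q hq
    exact ⟨_, _, isGauge_sq_dist ⟨hφF, hφG⟩ hqφ⟩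

theorem exists_hasDerivAt_sqrt_sq_add {δ : ℝ} (hδ : 0 < δ) (m e u : ℝ) :
    ∃ s, HasDerivAt (fun u' => √((m * u' + e) ^ 2 + δ)) s u ∧ ‖s‖ ≤ |m| := by
  have hpos : 0 < (m * u + e) ^ 2 + δ := by positivity
  have hderiv : HasDerivAt (fun u' => √((m * u' + e) ^ 2 + δ))
      ((2 * (m * u + e) * m) / (2 * √((m * u + e) ^ 2 + δ))) u := by
    refine HasDerivAt.sqrt (HasDerivAt.add_const δ ?_) hpos.ne'
    simpa using (((hasDerivAt_id u).const_mul m).add_const e).fun_pow 2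
  refine ⟨_, hderiv, ?_⟩
  have hle : |m * u + e| ≤ √((m * u + e) ^ 2 + δ) := Real.abs_le_sqrt (by linarith)
  have hsqrt := Real.sqrt_pos.2 hpos
  simp only [Real.norm_eq_abs, abs_div, abs_mul, abs_two, abs_of_pos hsqrt]
  rw [div_le_iff₀ (by positivity)]
  nlinarith [mul_le_mul_of_nonneg_right hle (abs_nonneg m)]

variable {q : X} {O : Set X} {M : X → ℝ}

theorem IsStraight.exists_hasDerivAt_sqrt_gauge (h : IsStraight F G c σ a b) (hc : 0 ≤ c)
    (hM : IsGauge F G q O M) {η : ℝ} (hη : 0 < η) {u : ℝ} (hu : u ∈ Set.Ioo a b) (huO : σ u ∈ O) :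
    ∃ s, HasDerivAt (fun u' => √(η ^ 2 + M (σ u'))) s u ∧ ‖s‖ ≤ c := by
  obtain ⟨φ, hφ, huφ, a', b', hMφ⟩ := hM.chart _ huO (h.notMem_sing u hu)
  obtain ⟨⟨ε, e, hε, hfst⟩, hsnd⟩ := h.horizontal u hu φ hφ huφ
  have hσu : ContinuousAt σ u := h.continuousOn.continuousAt (Ioo_mem_nhds hu.1 hu.2)
  have habs : |ε * c| = c := by rcases hε with rfl | rfl <;> simp [abs_of_nonneg hc]
  obtain ⟨s, hs, hsc⟩ := exists_hasDerivAt_sqrt_sq_add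
    (δ := ((φ (σ u)).2 - b') ^ 2 + η ^ 2) (by positivity) (ε * c) (e - a') u
  refine ⟨s, hs.congr_of_eventuallyEq ?_, habs ▸ hsc⟩
  filter_upwards [hfst, hsnd, hσu.eventually hMφ] with u' hu'_fst hu'_snd hu'M
  rw [hu'M, hu'_fst, hu'_snd, id_eq]
  congr 1
  ring

theorem IsStraight.sqrt_gauge_le (h : IsStraight F G c σ a b) (hc : 0 ≤ c) (hM : IsGauge F G q O M)
    {η : ℝ} (hη : 0 < η) {K : Set ℝ} (hK : Convex ℝ K) (hKO : K ⊆ Set.Ioo a b ∩ σ ⁻¹' O) {u v : ℝ}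
    (hu : u ∈ K) (hv : v ∈ K) :
    √(η ^ 2 + M (σ v)) ≤ √(η ^ 2 + M (σ u)) + c * (b - a) := by
  have hderiv : ∀ w ∈ K, ∃ s, HasDerivAt (fun u' => √(η ^ 2 + M (σ u'))) s w ∧ ‖s‖ ≤ c :=
    fun w hw => h.exists_hasDerivAt_sqrt_gauge hc hM hη (hKO hw).1 (hKO hw).2
  choose! s hs hsc using hderiv
  have hlip := hK.norm_image_sub_le_of_norm_hasDerivWithin_le
    (fun w hw => (hs w hw).hasDerivWithinAt) hsc hu hv
  have hdist : ‖v - u‖ ≤ b - a := by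
    have hu_Ioo := (hKO hu).1
    have hv_Ioo := (hKO hv).1
    rw [Real.norm_eq_abs, abs_le]
    constructor <;> linarith [hu_Ioo.1, hu_Ioo.2, hv_Ioo.1, hv_Ioo.2]
  linarith [le_abs_self (√(η ^ 2 + M (σ v)) - √(η ^ 2 + M (σ u))),
    hlip.trans (mul_le_mul_of_nonneg_left hdist hc), Real.norm_eq_abs
      (√(η ^ 2 + M (σ v)) - √(η ^ 2 + M (σ u)))]

theorem mapsTo_of_mapsTo_connectedComponentIn {T : Type*} [TopologicalSpace T]
    [LocallyConnectedSpace T] {S : Set T} (hS : IsPreconnected S) (hS_open : IsOpen S) {f : T → X}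
    (hf : ContinuousOn f S) {O C : Set X} (hO : IsOpen O) (hC : IsClosed C) (hCO : C ⊆ O) {t : T}
    (ht : t ∈ S ∩ f ⁻¹' O) (h : Set.MapsTo f (connectedComponentIn (S ∩ f ⁻¹' O) t) C) :
    Set.MapsTo f S C := by
  set K := connectedComponentIn (S ∩ f ⁻¹' O) t
  have htK : t ∈ K := mem_connectedComponentIn ht
  refine h.mono_left (hS.subset_of_closure_inter_subset
    (hf.isOpen_inter_preimage hS_open hO).connectedComponentIn ⟨t, ht.1, htK⟩ ?_)
  rintro x ⟨hxK, hxS⟩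
  have hfx : f x ∈ C := hC.mem_of_frequently_of_tendsto
    ((mem_closure_iff_frequently.1 hxK).mono h) (hf.continuousAt (hS_open.mem_nhds hxS))
  have hpre : IsPreconnected (insert x K) :=
    isPreconnected_connectedComponentIn.subset_closure (Set.subset_insert _ _)
      (Set.insert_subset hxK subset_closure)
  have hxW : x ∈ S ∩ f ⁻¹' O := ⟨hxS, hCO hfx⟩
  exact hpre.subset_connectedComponentIn (Set.mem_insert_of_mem _ htK)
    (Set.insert_subset hxW (connectedComponentIn_subset _ _)) (Set.mem_insert _ _)

theorem Transverse.exists_nhds_isStraight_mapsTo [T2Space X] (hFG : F.Transverse G) {V : Set X}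
    (hV : V ∈ 𝓝 q) :
    ∃ U ∈ 𝓝 q, ∃ r > 0, ∀ (σ : ℝ → X) (a b c : ℝ), 0 ≤ c → IsStraight F G c σ a b →
      c * (b - a) ≤ r → ∀ u₀ ∈ Set.Ioo a b, σ u₀ ∈ U → Set.MapsTo σ (Set.Ioo a b) V := by
  obtain ⟨O, M, hM⟩ := hFG.exists_isGauge q
  obtain ⟨ρ, hρ, hclosed, hsub⟩ := hM.basis V hV
  obtain ⟨η, hη, hηρ⟩ : ∃ η > 0, 9 * η ^ 2 = ρ :=
    ⟨√ρ / 3, by positivity, by rw [div_pow, Real.sq_sqrt hρ.le]; ring⟩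
  refine ⟨O ∩ {x | M x < η ^ 2}, Filter.inter_mem (hM.isOpen.mem_nhds hM.mem) ?_, η, hη, ?_⟩
  · exact hM.continuousAt.eventually_lt continuousAt_const (by rw [hM.apply_self]; positivity)
  intro σ a b c hc hσ hshort u₀ hu₀ hσu₀
  have hu₀W : u₀ ∈ Set.Ioo a b ∩ σ ⁻¹' O := ⟨hu₀, hσu₀.1⟩
  refine Set.MapsTo.mono_right (mapsTo_of_mapsTo_connectedComponentIn isPreconnected_Ioo
    isOpen_Ioo hσ.continuousOn hM.isOpen hclosed (fun x hx => hx.1) hu₀W fun u hu => ?_) hsub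
  have huW := connectedComponentIn_subset _ _ hu
  refine ⟨huW.2, ?_⟩
  have hle := hσ.sqrt_gauge_le hc hM hη
    (Real.convex_iff_isPreconnected.2 isPreconnected_connectedComponentIn)
    (connectedComponentIn_subset _ _) (mem_connectedComponentIn hu₀W) hu
  have hstart : √(η ^ 2 + M (σ u₀)) ≤ 2 * η := by
    rw [Real.sqrt_le_left (by positivity)]
    nlinarith [show M (σ u₀) < η ^ 2 from hσu₀.2]
  have hend : √(η ^ 2 + M (σ u)) ≤ 3 * η := by linarith
  rw [Real.sqrt_le_left (by positivity)] at hend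
  nlinarith

end SingularMeasuredFoliation

end StraightSegments

section Contraction

variable {X : Type*} [TopologicalSpace X]

/-- The maps `g n` contract the set `A` uniformly as `n` tends to infinity: if `g n` takes some
point of `A` close to `q`, then it takes all of `A` close to `q`. -/
def IsContracted (g : ℕ → X → X) (A : Set X) : Prop :=
  ∀ q, ∀ V ∈ 𝓝 q, ∃ U ∈ 𝓝 q, ∃ N, ∀ n ≥ N, (∃ a ∈ A, g n a ∈ U) → ∀ a ∈ A, g n a ∈ V

namespace IsContracted

variable {g : ℕ → X → X} {A B : Set X}

theorem singleton (x : X) : IsContracted g {x} := by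
  refine fun q V hV => ⟨V, hV, 0, fun n _ => ?_⟩
  rintro ⟨_, rfl, h⟩ _ rfl
  exact h

theorem mono (h : IsContracted g B) (hAB : A ⊆ B) : IsContracted g A := by
  intro q V hV
  obtain ⟨U, hU, N, hN⟩ := h q V hV
  exact ⟨U, hU, N, fun n hn ⟨a, ha, haU⟩ a' ha' => hN n hn ⟨a, hAB ha, haU⟩ a' (hAB ha')⟩

theorem union (hA : IsContracted g A) (hB : IsContracted g B) {p : X} (hpA : p ∈ A) (hpB : p ∈ B) :
    IsContracted g (A ∪ B) := by
  intro q V hV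
  obtain ⟨U, hU, N, hN⟩ : ∃ U ∈ 𝓝 q, ∃ N, ∀ n ≥ N, g n p ∈ U → ∀ a ∈ A ∪ B, g n a ∈ V := by
    obtain ⟨UA, hUA, NA, hNA⟩ := hA q V hV
    obtain ⟨UB, hUB, NB, hNB⟩ := hB q V hV
    refine ⟨UA ∩ UB, Filter.inter_mem hUA hUB, max NA NB, fun n hn hp a ha => ?_⟩
    rcases ha with ha | ha
    · exact hNA n ((le_max_left _ _).trans hn) ⟨p, hpA, hp.1⟩ a ha
    · exact hNB n ((le_max_right _ _).trans hn) ⟨p, hpB, hp.2⟩ a ha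
  obtain ⟨UA, hUA, NA, hNA⟩ := hA q U hU
  obtain ⟨UB, hUB, NB, hNB⟩ := hB q U hU
  refine ⟨UA ∩ UB, Filter.inter_mem hUA hUB, max N (max NA NB), fun n hn => ?_⟩
  simp only [ge_iff_le, max_le_iff] at hn
  rintro ⟨a, ha | ha, haU⟩
  · exact hN n hn.1 (hNA n hn.2.1 ⟨a, ha, haU.1⟩ p hpA)
  · exact hN n hn.1 (hNB n hn.2.2 ⟨a, ha, haU.2⟩ p hpB)

end IsContracted

theorem AffineAlong.of_eq_or_eq_neg {T : Type*} [TopologicalSpace T] {f g : T → ℝ} {t : T}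
    (hf : ContinuousAt f t) (hg : ContinuousAt g t) (hgt : g t ≠ 0)
    (h : ∀ᶠ s in 𝓝 t, f s = g s ∨ f s = -g s) : AffineAlong 1 (𝓝 t) f g := by
  rcases h.self_of_nhds with hfg | hfg
  · have hne : f t ≠ -g t := by rwa [hfg, ne_eq, self_eq_neg]
    refine ⟨1, 0, Or.inl rfl, ?_⟩
    filter_upwards [h, (hf.ne_iff_eventually_ne hg.neg).1 hne] with s hs hs_ne
    simpa using hs.resolve_right hs_ne
  · have hne : f t ≠ g t := by rwa [hfg, ne_eq, neg_eq_self]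
    refine ⟨-1, 0, Or.inr rfl, ?_⟩
    filter_upwards [h, (hf.ne_iff_eventually_ne hg).1 hne] with s hs hs_ne
    simpa using hs.resolve_left hs_ne

theorem IsProngBranch.apply_eq_or_eq_neg {ζ : OpenPartialHomeomorph X ℂ} {p x : X} {k : ℕ}
    {φ : OpenPartialHomeomorph X (ℝ × ℝ)} (hφ : IsProngBranch ζ p k φ) (hx : x ∈ φ.source) {u : ℝ}
    (h : ζ x ^ k = (u : ℂ) ^ 2) : φ x = (u, 0) ∨ φ x = (-u, 0) := by
  refine (sq_eq_sq_iff_eq_or_eq_neg.1 ((hφ.2 x hx).trans h)).imp (fun heq => ?_) fun heq => ?_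
  all_goals
    rw [Complex.ext_iff] at heq
    exact Prod.ext (by simpa using heq.1) (by simpa using heq.2)

/-- The ray from `0` in the direction `ω`, parametrized so that the point at parameter `u` has
modulus `u ^ (2 / k)`. For `ω ^ k = 1` this is a prong of a `k`-prong singularity, at unit speed. -/
noncomputable def prongRay (k : ℕ) (ω : ℂ) (u : ℝ) : ℂ := ω * ((u ^ (2 / k : ℝ) : ℝ) : ℂ)

section ProngRay

variable {k : ℕ} {ω : ℂ} {r u : ℝ}

theorem continuous_prongRay (k : ℕ) (ω : ℂ) : Continuous (prongRay k ω) :=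
  continuous_const.mul (Complex.continuous_ofReal.comp (Real.continuous_rpow_const (by positivity)))

theorem prongRay_zero (hk : k ≠ 0) (ω : ℂ) : prongRay k ω 0 = 0 := by
  simp [prongRay, Real.zero_rpow, hk]

theorem prongRay_pow (hk : k ≠ 0) (hω : ω ^ k = 1) (hu : 0 ≤ u) :
    prongRay k ω u ^ k = (u : ℂ) ^ 2 := by
  rw [prongRay, mul_pow, hω, one_mul, ← Complex.ofReal_pow, ← Real.rpow_natCast, ← Real.rpow_mul hu,
    div_mul_cancel₀ _ (by exact_mod_cast hk), Real.rpow_two, Complex.ofReal_pow]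

theorem rpow_rpow_two_div (hk : k ≠ 0) (hr : 0 ≤ r) : (r ^ (k / 2 : ℝ)) ^ (2 / k : ℝ) = r := by
  have hk_real : (k : ℝ) ≠ 0 := by exact_mod_cast hk
  rw [← Real.rpow_mul hr, div_mul_div_cancel₀ two_ne_zero, div_self hk_real, Real.rpow_one]

theorem prongRay_mem_ball (hk : k ≠ 0) (hω : ω ^ k = 1) (hr : 0 ≤ r)
    (hu : u ∈ Set.Ico 0 (r ^ (k / 2 : ℝ))) : prongRay k ω u ∈ Metric.ball 0 r := by
  rw [mem_ball_zero_iff, prongRay, norm_mul, Complex.norm_eq_one_of_pow_eq_one hω hk, one_mul,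
    Complex.norm_real, Real.norm_of_nonneg (Real.rpow_nonneg hu.1 _)]
  calc u ^ (2 / k : ℝ) < (r ^ (k / 2 : ℝ)) ^ (2 / k : ℝ) :=
        Real.rpow_lt_rpow hu.1 hu.2 (by positivity)
    _ = r := rpow_rpow_two_div hk hr

theorem exists_mem_image_prongRay (hk : k ≠ 0) {Z : ℂ} (hZ : ‖Z ^ k‖ - (Z ^ k).re = 0)
    (hZr : ‖Z‖ < r) : ∃ ω : ℂ, ω ^ k = 1 ∧ Z ∈ prongRay k ω '' Set.Ico 0 (r ^ (k / 2 : ℝ)) := by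
  rcases eq_or_ne Z 0 with rfl | hZ₀
  · exact ⟨1, one_pow k, 0, ⟨le_rfl, Real.rpow_pos_of_pos (by simpa using hZr) _⟩,
      prongRay_zero hk 1⟩
  have hnorm : (‖Z‖ : ℂ) ≠ 0 := Complex.ofReal_ne_zero.2 (norm_ne_zero_iff.2 hZ₀)
  refine ⟨Z / ‖Z‖, ?_, ‖Z‖ ^ (k / 2 : ℝ), ⟨by positivity, ?_⟩, ?_⟩
  · rw [div_pow, eq_norm_of_norm_sub_re_eq_zero hZ, norm_pow, Complex.ofReal_pow,
      div_self (pow_ne_zero k hnorm)]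
  · exact Real.rpow_lt_rpow (norm_nonneg Z) hZr (by positivity)
  · rw [prongRay, rpow_rpow_two_div hk (norm_nonneg Z), div_mul_cancel₀ _ hnorm]

end ProngRay

namespace SingularMeasuredFoliation

variable {F G : SingularMeasuredFoliation X}

theorem isStraight_plaque {φ : OpenPartialHomeomorph X (ℝ × ℝ)} (hφ : IsPairChart F G φ)
    {y a b : ℝ} (h : ∀ u ∈ Set.Ioo a b, (u, y) ∈ φ.target) :
    IsStraight F G 1 (fun u => φ.symm (u, y)) a b := by
  refine .of_exists_chart (φ.continuousOn_symm.comp (by fun_prop) h) fun u hu => ?_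
  have hright : ∀ᶠ u' in 𝓝 u, φ (φ.symm (u', y)) = (u', y) := by
    filter_upwards [Ioo_mem_nhds hu.1 hu.2] with u' hu'
    exact φ.right_inv (h u' hu')
  refine ⟨φ, hφ, φ.map_target (h u hu), ⟨1, 0, Or.inl rfl, ?_⟩, ?_⟩
  · filter_upwards [hright] with u' hu'
    simp [hu']
  · filter_upwards [hright] with u' hu'
    rw [hu', φ.right_inv (h u hu)]

variable {ζ : OpenPartialHomeomorph X ℂ} {p : X} {k : ℕ}

theorem isStraight_prongRay (hk : k ≠ 0) (hζp : ζ p = 0)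
    (hζ : ∀ φ, IsProngBranch ζ p k φ → IsPairChart F G φ) {ω : ℂ} (hω : ω ^ k = 1) {b : ℝ}
    (h : ∀ u ∈ Set.Ioo 0 b, prongRay k ω u ∈ ζ.target) :
    IsStraight F G 1 (fun u => ζ.symm (prongRay k ω u)) 0 b := by
  set σ := fun u => ζ.symm (prongRay k ω u)
  have hσ : ContinuousOn σ (Set.Ioo 0 b) :=
    ζ.continuousOn_symm.comp (continuous_prongRay k ω).continuousOn h
  have hpow : ∀ u ∈ Set.Ioo 0 b, ζ (σ u) ^ k = (u : ℂ) ^ 2 := fun u hu => by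
    rw [show ζ (σ u) = prongRay k ω u from ζ.right_inv (h u hu), prongRay_pow hk hω hu.1.le]
  refine .of_exists_chart hσ fun u hu => ?_
  have hζσ : ζ (σ u) ≠ 0 := by
    rw [← pow_ne_zero_iff hk, hpow u hu]
    exact pow_ne_zero 2 (Complex.ofReal_ne_zero.2 hu.1.ne')
  obtain ⟨φ, hφ, huφ⟩ := exists_isProngBranch hk hζp (ζ.map_target (h u hu)) hζσ
  have hσu : ContinuousAt σ u := hσ.continuousAt (Ioo_mem_nhds hu.1 hu.2)
  have hφσ : ∀ᶠ u' in 𝓝 u, φ (σ u') = (u', 0) ∨ φ (σ u') = (-u', 0) := by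
    filter_upwards [Ioo_mem_nhds hu.1 hu.2, hσu (φ.open_source.mem_nhds huφ)] with u' hu' hu'φ
    exact hφ.apply_eq_or_eq_neg hu'φ (hpow u' hu')
  have hsnd : ∀ᶠ u' in 𝓝 u, (φ (σ u')).2 = 0 := hφσ.mono fun u' hu' => by
    rcases hu' with hu' | hu' <;> rw [hu']
  refine ⟨φ, hζ φ hφ, huφ, ?_, hsnd.mono fun u' hu' => hu'.trans hsnd.self_of_nhds.symm⟩
  have hφσu : ContinuousAt (fun u' => φ (σ u')) u :=
    ContinuousAt.comp (g := φ) (φ.continuousAt huφ) hσu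
  refine .of_eq_or_eq_neg hφσu.fst continuousAt_id hu.1.ne' ?_
  exact hφσ.mono fun u' hu' => hu'.imp (fun hu' => by rw [hu', id_eq]) fun hu' => by rw [hu', id_eq]

/-- The maps `g n` take straight segments to straight segments of speeds tending to zero. -/
structure ContractsLeaves (F G : SingularMeasuredFoliation X) (g : ℕ → X → X) (c : ℕ → ℝ) :
    Prop where
  continuous : ∀ n, Continuous (g n)
  nonneg : ∀ n, 0 ≤ c n
  tendsto : Filter.Tendsto c Filter.atTop (𝓝 0)
  isStraight : ∀ n σ a b, IsStraight F G 1 σ a b → IsStraight F G (c n) (g n ∘ σ) a b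

namespace ContractsLeaves

variable [T3Space X] {g : ℕ → X → X} {c : ℕ → ℝ}

theorem exists_nhds_segment (hg : ContractsLeaves F G g c) (hFG : F.Transverse G) (l : ℝ) {q : X}
    {V : Set X} (hV : V ∈ 𝓝 q) :
    ∃ U ∈ 𝓝 q, ∃ N, ∀ n ≥ N, ∀ σ a b, IsStraight F G 1 σ a b → b - a ≤ l →
      ∀ x ∈ closure (σ '' Set.Ioo a b), ∀ y ∈ closure (σ '' Set.Ioo a b),
        g n x ∈ U → g n y ∈ V := by
  obtain ⟨C, hC, hC_closed, hCV⟩ := exists_mem_nhds_isClosed_subset hV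
  obtain ⟨U, hU, r, hr, hmaps⟩ := hFG.exists_nhds_isStraight_mapsTo hC
  have hspeed : Filter.Tendsto (fun n => c n * l) Filter.atTop (𝓝 0) := by
    simpa using hg.tendsto.mul_const l
  obtain ⟨N, hN⟩ := Filter.eventually_atTop.1 (hspeed.eventually_lt_const hr)
  refine ⟨interior U, interior_mem_nhds.2 hU, N, fun n hn σ a b hσ hab x hx y hy hxU => hCV ?_⟩
  obtain ⟨_, hu₀U, u₀, hu₀, rfl⟩ :=
    mem_closure_iff.1 hx _ (isOpen_interior.preimage (hg.continuous n)) hxU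
  have hlength : c n * (b - a) ≤ r :=
    (mul_le_mul_of_nonneg_left hab (hg.nonneg n)).trans (hN n hn).le
  have hsegment := hmaps _ a b (c n) (hg.nonneg n) (hg.isStraight n σ a b hσ) hlength u₀ hu₀
    (interior_subset hu₀U)
  exact hC_closed.closure_subset
    (map_mem_closure (hg.continuous n) hy (Set.mapsTo_image_iff.2 hsegment))

theorem isContracted_of_segments (hg : ContractsLeaves F G g c) (hFG : F.Transverse G) {A : Set X}
    {p : X} {l : ℝ} (hA : ∀ x ∈ A, ∃ σ a b, IsStraight F G 1 σ a b ∧ b - a ≤ l ∧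
      x ∈ closure (σ '' Set.Ioo a b) ∧ p ∈ closure (σ '' Set.Ioo a b)) : IsContracted g A := by
  intro q V hV
  obtain ⟨U, hU, N, hN⟩ := hg.exists_nhds_segment hFG l hV
  obtain ⟨U', hU', N', hN'⟩ := hg.exists_nhds_segment hFG l hU
  refine ⟨U', hU', max N N', fun n hn => ?_⟩
  rintro ⟨x, hx, hxU'⟩ y hy
  obtain ⟨σ, a, b, hσ, hab, hxσ, hpσ⟩ := hA x hx
  obtain ⟨τ, a', b', hτ, hab', hyτ, hpτ⟩ := hA y hy
  have hpU : g n p ∈ U := hN' n ((le_max_right _ _).trans hn) σ a b hσ hab x hxσ p hpσ hxU'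
  exact hN n ((le_max_left _ _).trans hn) τ a' b' hτ hab' p hpτ y hyτ hpU

theorem isContracted_star (hg : ContractsLeaves F G g c) (hFG : F.Transverse G) (hk : k ≠ 0)
    (hp : p ∈ ζ.source) (hζp : ζ p = 0) (hζ : ∀ φ, IsProngBranch ζ p k φ → IsPairChart F G φ)
    {r : ℝ} (hr : 0 < r) (hball : Metric.ball 0 r ⊆ ζ.target) :
    IsContracted g {x ∈ ζ.source | ‖ζ x‖ < r ∧ ‖ζ x ^ k‖ - (ζ x ^ k).re = 0} := by
  have hb : 0 < r ^ (k / 2 : ℝ) := Real.rpow_pos_of_pos hr _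
  refine hg.isContracted_of_segments hFG (p := p) (l := r ^ (k / 2 : ℝ)) ?_
  rintro x ⟨hx, hxr, hxk⟩
  obtain ⟨ω, hω, u, hu, hux⟩ := exists_mem_image_prongRay hk hxk hxr
  have htarget : ∀ v ∈ Set.Ico 0 (r ^ (k / 2 : ℝ)), prongRay k ω v ∈ ζ.target :=
    fun v hv => hball (prongRay_mem_ball hk hω hr.le hv)
  have hclosure : ∀ v ∈ Set.Ico 0 (r ^ (k / 2 : ℝ)), ζ.symm (prongRay k ω v) ∈
      closure ((fun v => ζ.symm (prongRay k ω v)) '' Set.Ioo 0 (r ^ (k / 2 : ℝ))) := by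
    intro v hv
    have hcont : ContinuousAt (fun v => ζ.symm (prongRay k ω v)) v :=
      (ζ.continuousAt_symm (htarget v hv)).comp (continuous_prongRay k ω).continuousAt
    refine hcont.continuousWithinAt.mem_closure_image ?_
    rw [closure_Ioo hb.ne]
    exact Set.Ico_subset_Icc_self hv
  refine ⟨_, 0, _, isStraight_prongRay hk hζp hζ hω fun v hv =>
    htarget v (Set.Ioo_subset_Ico_self hv), by simp, ?_, ?_⟩
  · simpa only [hux, ζ.left_inv hx] using hclosure u hu
  · simpa only [prongRay_zero hk, ← hζp, ζ.left_inv hp] using hclosure 0 ⟨le_rfl, hb⟩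

theorem isContracted_plaque (hg : ContractsLeaves F G g c) (hFG : F.Transverse G)
    {φ : OpenPartialHomeomorph X (ℝ × ℝ)} (hφ : IsPairChart F G φ) {v : ℝ × ℝ} {r : ℝ} (hr : 0 < r)
    (hball : Metric.ball v r ⊆ φ.target) :
    IsContracted g {x ∈ φ.source | (φ x).2 = v.2 ∧ (φ x).1 ∈ Set.Ioo (v.1 - r) (v.1 + r)} := by
  have htarget : ∀ u ∈ Set.Ioo (v.1 - r) (v.1 + r), (u, v.2) ∈ φ.target := by
    refine fun u hu => hball ?_
    rw [← Real.ball_eq_Ioo] at hu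
    rw [Metric.mem_ball, Prod.dist_eq]
    exact max_lt hu (by simpa using hr)
  refine hg.isContracted_of_segments hFG (p := φ.symm v) (l := 2 * r) ?_
  rintro x ⟨hx, hx_snd, hx_fst⟩
  refine ⟨_, _, _, isStraight_plaque hφ htarget, by linarith,
    subset_closure ⟨_, hx_fst, ?_⟩, subset_closure ⟨v.1, ⟨by linarith, by linarith⟩, rfl⟩⟩
  simp only [← hx_snd, Prod.mk.eta, φ.left_inv hx]

variable {γ : C(unitInterval, X)}

theorem exists_nhds_isContracted_of_mem_sing (hg : ContractsLeaves F G g c) (hFG : F.Transverse G)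
    (hγ : F.IsLeafPath γ) {t : unitInterval} (ht : γ t ∈ F.sing) :
    ∃ N ∈ 𝓝 t, IsContracted g (γ '' N) := by
  obtain ⟨k, hk, ζ, hpζ, hζp, hζ⟩ := hFG.singular _ ht
  have hk₀ : k ≠ 0 := by omega
  obtain ⟨r, hr, hball⟩ := Metric.isOpen_iff.1 ζ.open_target 0 (hζp ▸ ζ.map_source hpζ)
  have hnear : γ ⁻¹' (ζ.source ∩ {x | ‖ζ x‖ < r}) ∈ 𝓝 t := by
    refine γ.continuous.continuousAt (Filter.inter_mem (ζ.open_source.mem_nhds hpζ) ?_)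
    exact (ζ.continuousAt hpζ).norm.eventually_lt continuousAt_const (by simpa [hζp] using hr)
  obtain ⟨a, b, htab, hab, hab_sub⟩ := exists_Icc_mem_subset_of_mem_nhds hnear
  refine ⟨Set.Icc a b, hab, (hg.isContracted_star hFG hk₀ hpζ hζp hζ hr hball).mono ?_⟩
  rintro _ ⟨u, hu, rfl⟩
  refine ⟨(hab_sub hu).1, (hab_sub hu).2, ?_⟩
  rw [hγ.norm_sub_re_eq hk₀ hζp (fun φ hφ => (hζ φ hφ).1) isPreconnected_Icc
    (fun s hs => (hab_sub hs).1) hu htab]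
  simp [hζp, hk₀]

theorem exists_nhds_isContracted_of_notMem_sing (hg : ContractsLeaves F G g c)
    (hFG : F.Transverse G) (hγ : F.IsLeafPath γ) {t : unitInterval} (ht : γ t ∉ F.sing) :
    ∃ N ∈ 𝓝 t, IsContracted g (γ '' N) := by
  obtain ⟨φ, hφF, htφ, hφG⟩ := hFG.regular _ ht
  obtain ⟨r, hr, hball⟩ := Metric.isOpen_iff.1 φ.open_target _ (φ.map_source htφ)
  refine ⟨_, ?_, (hg.isContracted_plaque hFG ⟨hφF, hφG⟩ hr hball).mono
    (Set.image_preimage_subset γ _)⟩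
  have hγt := γ.continuous.continuousAt (x := t)
  filter_upwards [hγt (φ.open_source.mem_nhds htφ), hγ t φ hφF htφ,
    ((φ.continuousAt htφ).comp hγt).fst
      (Ioo_mem_nhds (sub_lt_self _ hr) (lt_add_of_pos_right _ hr))]
    with u hu hu_snd hu_fst
  exact ⟨hu, hu_snd, hu_fst⟩

theorem isContracted_range (hg : ContractsLeaves F G g c) (hFG : F.Transverse G)
    (hγ : F.IsLeafPath γ) : IsContracted g (Set.range γ) := by
  have hlocal : ∀ t, ∃ N ∈ 𝓝 t, IsContracted g (γ '' N) := fun t => by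
    by_cases ht : γ t ∈ F.sing
    · exact hg.exists_nhds_isContracted_of_mem_sing hFG hγ ht
    · exact hg.exists_nhds_isContracted_of_notMem_sing hFG hγ ht
  choose N hN hNg using hlocal
  obtain ⟨t, ht₀, ht_mono, ⟨n, hn⟩, htN⟩ := exists_monotone_Icc_subset_open_cover_unitInterval
    (c := fun s => interior (N s)) (fun _ => isOpen_interior)
    (fun s _ => Set.mem_iUnion.2 ⟨s, mem_interior_iff_mem_nhds.2 (hN s)⟩)
  have hinitial : ∀ m, IsContracted g (γ '' Set.Icc 0 (t m)) := by
    intro m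
    induction m with
    | zero => simpa [ht₀] using IsContracted.singleton (γ 0)
    | succ m ih =>
      obtain ⟨i, hi⟩ := htN m
      have hstep := (hNg i).mono (Set.image_mono (hi.trans interior_subset))
      have htm : 0 ≤ t m := unitInterval.nonneg'
      rw [← Set.Icc_union_Icc_eq_Icc htm (ht_mono m.le_succ), Set.image_union]
      exact ih.union hstep (p := γ (t m)) ⟨_, ⟨htm, le_rfl⟩, rfl⟩
        ⟨_, ⟨le_rfl, ht_mono m.le_succ⟩, rfl⟩
  refine (hinitial n).mono ?_
  rintro _ ⟨s, rfl⟩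
  exact ⟨s, ⟨unitInterval.nonneg', by rw [hn n le_rfl]; exact unitInterval.le_one'⟩, rfl⟩

end ContractsLeaves

theorem isArational_of_contracting [T3Space X] (hFG : F.Transverse G) {K : Set X} (hK : IsCompact K)
    {c : ℝ} (hc₀ : 0 < c) (hc₁ : c < 1)
    (hg : ∀ (n : ℕ) (x : X), ∃ g : X ≃ₜ X, g x ∈ K ∧ F.HasImage g (c ^ n) F ∧
      G.HasImage g (c ^ n)⁻¹ G) : F.IsArational := by
  intro γ hγ hinj
  choose g hgK hgF hgG using fun n => hg n (γ 0)
  have hcn : ∀ n, c ^ n ≠ 0 := fun n => pow_ne_zero _ hc₀.ne'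
  have hcontracts : ContractsLeaves F G (fun n => g n) (fun n => c ^ n) :=
    { continuous := fun n => (g n).continuous
      nonneg := fun n => by positivity
      tendsto := tendsto_pow_atTop_nhds_zero_of_lt_one hc₀.le hc₁
      isStraight := fun n σ a b h => by
        simpa using h.image (g n).continuous (hgF n) (hcn n) (hgG n) (inv_ne_zero (hcn n)) hFG }
  obtain ⟨q, -, hq⟩ := hK.exists_clusterPt (f := Filter.map (fun n => g n (γ 0)) Filter.atTop)
    (by simp [hgK])
  obtain ⟨V, hV, hVγ⟩ := F.exists_nhds_leafPath_ne_and_subsingleton q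
  obtain ⟨U, hU, N, hN⟩ := hcontracts.isContracted_range hFG hγ q V hV
  obtain ⟨n, hn, hnU⟩ := Filter.frequently_atTop.1 (mapClusterPt_iff_frequently.1 hq U hU) N
  have hrange := hN n hn ⟨γ 0, ⟨0, rfl⟩, hnU⟩
  obtain ⟨hne, hsing⟩ := hVγ _ (hγ.comp_of_hasImage (hcn n) ⟨g n, (g n).continuous⟩ (hgF n))
    ((g n).injective.comp_injOn hinj) fun t => hrange _ ⟨t, rfl⟩
  refine ⟨fun hclosed => hne (congrArg (g n) hclosed), fun s hs t ht => hsing ?_ ?_⟩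
  · exact ((hgF n).mem_sing_iff _).2 hs
  · exact ((hgF n).mem_sing_iff _).2 ht

end SingularMeasuredFoliation

end Contraction

section LocalHomomorphisms

variable {V M : Type*} [NormedAddCommGroup V] [NormedSpace ℝ V] [Monoid M] {ε : ℝ} {τ : V → M}

/-- `τ` is multiplicative wherever the two summands and the sum lie in the ball of radius `ε`. -/
def IsLocallyMultiplicative (τ : V → M) (ε : ℝ) : Prop :=
  ∀ v w, ‖v‖ < ε → ‖w‖ < ε → ‖v + w‖ < ε → τ (v + w) = τ v * τ w

theorem norm_inv_natCast_smul_lt (hε : 0 < ε) {v : V} {n : ℕ} (hn : ‖v‖ / ε < n) :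
    ‖(n : ℝ)⁻¹ • v‖ < ε := by
  have hpos : (0 : ℝ) < n := (by positivity : 0 ≤ ‖v‖ / ε).trans_lt hn
  rw [norm_smul, norm_inv, Real.norm_natCast, inv_mul_lt_iff₀ hpos]
  exact (div_lt_iff₀ hε).1 hn

theorem exists_eq_nsmul_of_norm_lt (hε : 0 < ε) (v : V) :
    ∃ (n : ℕ) (u : V), ‖u‖ < ε ∧ v = n • u := by
  obtain ⟨n, hn⟩ := exists_nat_gt (‖v‖ / ε)
  have hpos : (0 : ℝ) < n := (by positivity : 0 ≤ ‖v‖ / ε).trans_lt hn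
  refine ⟨n, (n : ℝ)⁻¹ • v, norm_inv_natCast_smul_lt hε hn, ?_⟩
  rw [← Nat.cast_smul_eq_nsmul ℝ, smul_inv_smul₀ hpos.ne']

theorem IsLocallyMultiplicative.map_nsmul (hτ : IsLocallyMultiplicative τ ε) {u : V} {n : ℕ}
    (hn : 0 < n) (hu : ‖n • u‖ < ε) : τ (n • u) = τ u ^ n := by
  induction n, hn using Nat.le_induction with
  | base => simp
  | succ n hn ih =>
    have hlt : ∀ k ≤ n + 1, ‖k • u‖ < ε := fun k hk => by
      rw [RCLike.norm_nsmul ℝ] at hu ⊢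
      exact (nsmul_le_nsmul_left (norm_nonneg u) hk).trans_lt hu
    have hu₁ : ‖u‖ < ε := by simpa using hlt 1 (by omega)
    rw [succ_nsmul, hτ _ _ (hlt n n.le_succ) hu₁ (succ_nsmul u n ▸ hu), ih (hlt n n.le_succ),
      pow_succ]

theorem IsLocallyMultiplicative.pow_inv_natCast_smul_eq (hτ : IsLocallyMultiplicative τ ε)
    {v : V} {n m : ℕ} (hn : 0 < n) (hm : 0 < m) (hnv : ‖(n : ℝ)⁻¹ • v‖ < ε)
    (hmv : ‖(m : ℝ)⁻¹ • v‖ < ε) :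
    τ ((n : ℝ)⁻¹ • v) ^ n = τ ((m : ℝ)⁻¹ • v) ^ m := by
  have hn' : (n : ℝ) ≠ 0 := by exact_mod_cast hn.ne'
  have hm' : (m : ℝ) ≠ 0 := by exact_mod_cast hm.ne'
  obtain ⟨u, hnu, hmu⟩ : ∃ u : V, (n : ℝ)⁻¹ • v = m • u ∧ (m : ℝ)⁻¹ • v = n • u := by
    refine ⟨(n : ℝ)⁻¹ • (m : ℝ)⁻¹ • v, ?_, ?_⟩
    · rw [← Nat.cast_smul_eq_nsmul ℝ, smul_comm, smul_inv_smul₀ hm']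
    · rw [← Nat.cast_smul_eq_nsmul ℝ, smul_inv_smul₀ hn']
  rw [hnu] at hnv ⊢
  rw [hmu] at hmv ⊢
  rw [hτ.map_nsmul hm hnv, hτ.map_nsmul hn hmv, ← pow_mul, ← pow_mul, mul_comm]

theorem IsLocallyMultiplicative.exists_forall_eq_pow (hτ : IsLocallyMultiplicative τ ε)
    (hε : 0 < ε) : ∃ T : V → M, ∀ (v : V) (n : ℕ), ‖v‖ / ε < n → T v = τ ((n : ℝ)⁻¹ • v) ^ n := by
  have hpos : ∀ {v : V} {n : ℕ}, ‖v‖ / ε < n → 0 < n := fun {v n} hn => by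
    exact_mod_cast (by positivity : 0 ≤ ‖v‖ / ε).trans_lt hn
  choose N hN using fun v : V => exists_nat_gt (‖v‖ / ε)
  exact ⟨fun v => τ ((N v : ℝ)⁻¹ • v) ^ N v, fun v n hn =>
    hτ.pow_inv_natCast_smul_eq (hpos (hN v)) (hpos hn) (norm_inv_natCast_smul_lt hε (hN v))
      (norm_inv_natCast_smul_lt hε hn)⟩

theorem IsLocallyMultiplicative.exists_extension (hτ : IsLocallyMultiplicative τ ε) (hε : 0 < ε) :
    ∃ T : V → M, (∀ v w, T (v + w) = T v * T w) ∧ ∀ v, ‖v‖ < ε → T v = τ v := by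
  obtain ⟨T, hT⟩ := hτ.exists_forall_eq_pow hε
  refine ⟨T, fun v w => ?_, fun v hv => ?_⟩
  · obtain ⟨n, hn⟩ := exists_nat_gt ((‖v‖ + ‖w‖) / ε)
    have hnv : ‖v‖ / ε < n := lt_of_le_of_lt (by gcongr; linarith [norm_nonneg w]) hn
    have hnw : ‖w‖ / ε < n := lt_of_le_of_lt (by gcongr; linarith [norm_nonneg v]) hn
    have hnvw : ‖v + w‖ / ε < n := lt_of_le_of_lt (by gcongr; exact norm_add_le v w) hn
    have hv := norm_inv_natCast_smul_lt hε hnv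
    have hw := norm_inv_natCast_smul_lt hε hnw
    have hvw := norm_inv_natCast_smul_lt hε hnvw
    rw [hT v n hnv, hT w n hnw, hT (v + w) n hnvw]
    rw [smul_add] at hvw ⊢
    have hcomm : Commute (τ ((n : ℝ)⁻¹ • v)) (τ ((n : ℝ)⁻¹ • w)) := by
      rw [commute_iff_eq, ← hτ _ _ hv hw hvw, ← hτ _ _ hw hv (by rwa [add_comm]), add_comm]
    rw [hτ _ _ hv hw hvw, hcomm.mul_pow]
  · simpa using hT v 1 (by rwa [div_lt_iff₀ hε, Nat.cast_one, one_mul])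

end LocalHomomorphisms

section PathLifting

variable {V X I : Type*} [TopologicalSpace V] [LinearOrder I] [TopologicalSpace I]
  [OrderClosedTopology I] {E : V → X} {a b c : I}

/-- Over the interval `[a, b]` the path `α` lifts through `E` from every starting point. -/
def LiftsOn (E : V → X) (α : I → X) (a b : I) : Prop :=
  ∀ v₀, E v₀ = α a →
    ∃ v : I → V, ContinuousOn v (Set.Icc a b) ∧ v a = v₀ ∧ ∀ t ∈ Set.Icc a b, E (v t) = α t

theorem LiftsOn.trans {α : I → X} (hab : a ≤ b) (hbc : b ≤ c) (h : LiftsOn E α a b)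
    (h' : LiftsOn E α b c) : LiftsOn E α a c := by
  intro v₀ hv₀
  obtain ⟨v, hv, hva, hvE⟩ := h v₀ hv₀
  obtain ⟨v', hv', hvb, hvE'⟩ := h' (v b) (hvE b ⟨hab, le_rfl⟩)
  refine ⟨fun t => if t ≤ b then v t else v' t, ?_, by simp [hab, hva], fun t ht => ?_⟩
  · rw [← Set.Icc_union_Icc_eq_Icc hab hbc]
    refine ContinuousOn.union_of_isClosed ?_ ?_ isClosed_Icc isClosed_Icc
    · exact hv.congr fun t ht => if_pos ht.2
    · refine hv'.congr fun t ht => ?_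
      rcases ht.1.eq_or_lt with rfl | hbt
      · simp [hvb]
      · exact if_neg hbt.not_ge
  · rcases le_or_gt t b with htb | hbt
    · simpa only [htb, if_true] using hvE t ⟨ht.1, htb⟩
    · simpa only [hbt.not_ge, if_false] using hvE' t ⟨hbt.le, ht.2⟩

theorem exists_continuous_lift_of_liftsOn {α : unitInterval → X}
    (hloc : ∀ t₀, ∃ N, IsOpen N ∧ t₀ ∈ N ∧ ∀ a b, a ≤ b → Set.Icc a b ⊆ N → LiftsOn E α a b)
    {v₀ : V} (hv₀ : E v₀ = α 0) :
    ∃ v : unitInterval → V, Continuous v ∧ v 0 = v₀ ∧ ∀ t, E (v t) = α t := by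
  choose N hNo hNt hN using hloc
  obtain ⟨t, ht0, ht_mono, ⟨n, ht1⟩, htN⟩ :=
    exists_monotone_Icc_subset_open_cover_unitInterval hNo fun s _ => Set.mem_iUnion.2 ⟨s, hNt s⟩
  have hlifts : ∀ m, LiftsOn E α 0 (t m) := by
    intro m
    induction m with
    | zero =>
      intro v₁ hv₁
      refine ⟨fun _ => v₁, continuousOn_const, rfl, fun s hs => ?_⟩
      rw [hv₁, le_antisymm (hs.2.trans_eq ht0) hs.1]
    | succ m ih =>
      obtain ⟨i, hi⟩ := htN m
      exact ih.trans (ht0 ▸ ht_mono m.zero_le) (ht_mono m.le_succ)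
        (hN i _ _ (ht_mono m.le_succ) hi)
  obtain ⟨v, hv, hv0, hvE⟩ := hlifts n v₀ hv₀
  have huniv : Set.Icc 0 (t n) = Set.univ :=
    Set.eq_univ_of_forall fun s => ⟨s.2.1, ht1 n le_rfl ▸ s.2.2⟩
  rw [huniv] at hv hvE
  exact ⟨v, continuousOn_univ.1 hv, hv0, fun t => hvE t trivial⟩

end PathLifting

theorem mul_mul_self_eq_one {M : Type*} [CommMonoid M] {a b : M} (ha : a * a = 1) (hb : b * b = 1) :
    a * b * (a * b) = 1 := by
  rw [mul_mul_mul_comm, ha, hb, one_mul]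

theorem norm_mul_of_mul_self {A : ℝ × ℝ} (hA : A * A = 1) (v : ℝ × ℝ) : ‖A * v‖ = ‖v‖ := by
  have habs : ∀ {a : ℝ}, a * a = 1 → |a| = 1 := fun ha => by
    rcases mul_self_eq_one_iff.1 ha with rfl | rfl <;> simp
  simp [Prod.norm_def, habs (congrArg Prod.fst hA), habs (congrArg Prod.snd hA)]

theorem eq_and_eq_of_eventually_affine {A B b d w₀ : ℝ × ℝ}
    (h : ∀ᶠ w in 𝓝 w₀, A * w + b = B * w + d) : A = B ∧ b = d := by
  have hdiag : Filter.Tendsto (fun t : ℝ => w₀ + (t, t)) (𝓝[≠] 0) (𝓝 w₀) := by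
    have : Continuous fun t : ℝ => w₀ + (t, t) := by fun_prop
    simpa [← Prod.zero_eq_mk] using (this.tendsto 0).mono_left nhdsWithin_le_nhds
  obtain ⟨t, ht, ht0⟩ := ((hdiag.eventually h).and self_mem_nhdsWithin).exists
  have hAB : A = B := by
    have hw₀ := h.self_of_nhds
    simp only [Prod.ext_iff, Prod.fst_add, Prod.snd_add, Prod.fst_mul, Prod.snd_mul] at ht hw₀
    refine Prod.ext (mul_right_cancel₀ ht0 ?_) (mul_right_cancel₀ ht0 ?_)
    · linarith [ht.1, hw₀.1]
    · linarith [ht.2, hw₀.2]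
  subst hAB
  exact ⟨rfl, add_left_cancel h.self_of_nhds⟩

/-! ### Flat structures and their developing maps -/

/-- A flat structure on `X` whose coordinate changes are locally of the form
`(x, y) ↦ (± x + a, ± y + b)`, with a chart around each point that contains a square of side `2 ε`.
The pair of signs is encoded as an element `A` of the ring `ℝ × ℝ` with `A * A = 1`, so that the
coordinate change reads `v ↦ A * v + b`. -/
structure FlatStructure (X : Type*) [TopologicalSpace X] (ε : ℝ) where
  pos : 0 < ε
  chart : X → OpenPartialHomeomorph X (ℝ × ℝ)
  mem_source : ∀ p, p ∈ (chart p).source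
  apply_self : ∀ p, chart p p = 0
  ball_subset : ∀ p, Metric.ball 0 ε ⊆ (chart p).target
  compatible : ∀ p q, ∀ x ∈ (chart p).source, x ∈ (chart q).source →
    ∃ A b : ℝ × ℝ, A * A = 1 ∧ ∀ᶠ x' in 𝓝 x, chart p x' = A * chart q x' + b

/-- A frame for a flat structure: a point with an orientation of the two axes there, recorded as
the pair of signs relative to the chart at that point. -/
@[ext]
structure Frame (X : Type*) where
  point : X
  sign : ℝ × ℝ
  sign_mul_self : sign * sign = 1

namespace Frame

variable {X : Type*}

/-- The frame whose axes are those of the chart at `p`. -/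
def standard (p : X) : Frame X := ⟨p, 1, one_mul 1⟩

/-- The frame obtained by changing the orientations of the axes by the signs `A`. -/
def act (A : ℝ × ℝ) (hA : A * A = 1) (s : Frame X) : Frame X :=
  ⟨s.point, A * s.sign, mul_mul_self_eq_one hA s.sign_mul_self⟩

theorem exists_eq_act {s s' : Frame X} (h : s.point = s'.point) :
    ∃ A, ∃ hA : A * A = 1, s = act A hA s' :=
  ⟨s.sign * s'.sign, mul_mul_self_eq_one s.sign_mul_self s'.sign_mul_self,
    Frame.ext h <| by simp only [act, mul_assoc, s'.sign_mul_self, mul_one]⟩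

end Frame

namespace FlatStructure

open Frame

variable {X : Type*} [TopologicalSpace X] {ε : ℝ} (S : FlatStructure X ε)

/-- The exponential map of a frame, which parametrizes the square of side `2 ε` about its point. -/
def exp (s : Frame X) (v : ℝ × ℝ) : X := (S.chart s.point).symm (s.sign * v)

include S in
theorem norm_zero_lt : ‖(0 : ℝ × ℝ)‖ < ε := by simpa using S.pos

theorem sign_mul_mem_target (s : Frame X) {v : ℝ × ℝ} (hv : ‖v‖ < ε) :
    s.sign * v ∈ (S.chart s.point).target :=
  S.ball_subset _ (by rwa [mem_ball_zero_iff, norm_mul_of_mul_self s.sign_mul_self])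

theorem exp_zero (s : Frame X) : S.exp s 0 = s.point := by
  rw [exp, mul_zero, ← S.apply_self s.point, (S.chart s.point).left_inv (S.mem_source _)]

theorem exp_mem_source (s : Frame X) {v : ℝ × ℝ} (hv : ‖v‖ < ε) :
    S.exp s v ∈ (S.chart s.point).source :=
  (S.chart s.point).map_target (S.sign_mul_mem_target s hv)

theorem chart_exp (s : Frame X) {v : ℝ × ℝ} (hv : ‖v‖ < ε) :
    S.chart s.point (S.exp s v) = s.sign * v :=
  (S.chart s.point).right_inv (S.sign_mul_mem_target s hv)

theorem continuousAt_exp (s : Frame X) {v : ℝ × ℝ} (hv : ‖v‖ < ε) : ContinuousAt (S.exp s) v :=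
  ContinuousAt.comp (f := fun v => s.sign * v) (g := (S.chart s.point).symm)
    ((S.chart s.point).continuousAt_symm (S.sign_mul_mem_target s hv)) (by fun_prop)

theorem continuousAt_exp_add (s : Frame X) {v w : ℝ × ℝ} (hvw : ‖v + w‖ < ε) :
    ContinuousAt (fun w => S.exp s (v + w)) w :=
  ContinuousAt.comp (f := fun w => v + w) (g := S.exp s) (S.continuousAt_exp s hvw) (by fun_prop)

theorem exp_act {A : ℝ × ℝ} (hA : A * A = 1) (s : Frame X) (v : ℝ × ℝ) :
    S.exp (act A hA s) v = S.exp s (A * v) := by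
  rw [exp, exp, act, mul_assoc, mul_left_comm]

theorem eventually_norm_add_lt {v w : ℝ × ℝ} (hvw : ‖v + w‖ < ε) : ∀ᶠ w' in 𝓝 w, ‖v + w'‖ < ε :=
  ContinuousAt.eventually_lt (by fun_prop) continuousAt_const hvw

theorem eq_of_eventually_exp_eq {s s' : Frame X} (h : ∀ᶠ w in 𝓝 0, S.exp s w = S.exp s' w) :
    s = s' := by
  have hpoint : s.point = s'.point := by simpa only [exp_zero] using h.self_of_nhds
  have hsign : ∀ᶠ w in 𝓝 (0 : ℝ × ℝ), s.sign * w + 0 = s'.sign * w + 0 := by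
    filter_upwards [h, continuous_norm.continuousAt.eventually_lt continuousAt_const S.norm_zero_lt]
      with w hw hlt
    rw [← S.chart_exp s hlt, ← S.chart_exp s' hlt, hw, hpoint]
  exact Frame.ext hpoint (eq_and_eq_of_eventually_affine hsign).1

theorem exists_eventually_exp_add_eq (s : Frame X) {v : ℝ × ℝ} (hv : ‖v‖ < ε) :
    ∃ s' : Frame X, ∀ᶠ w in 𝓝 0, S.exp s (v + w) = S.exp s' w := by
  set p := S.exp s v with hp
  obtain ⟨B, d, hB, hBd⟩ := S.compatible p s.point p (S.mem_source p) (S.exp_mem_source s hv)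
  have hd : d = -(B * (s.sign * v)) := by
    have := hBd.self_of_nhds
    rw [S.apply_self, hp, S.chart_exp s hv] at this
    exact eq_neg_of_add_eq_zero_right this.symm
  have hv0 : ‖v + 0‖ < ε := by rwa [add_zero]
  have htendsto : Filter.Tendsto (fun w => S.exp s (v + w)) (𝓝 0) (𝓝 p) := by
    simpa only [ContinuousAt, add_zero] using S.continuousAt_exp_add s hv0
  refine ⟨⟨p, B * s.sign, mul_mul_self_eq_one hB s.sign_mul_self⟩, ?_⟩
  filter_upwards [htendsto.eventually hBd, eventually_norm_add_lt hv0,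
    htendsto ((S.chart p).open_source.mem_nhds (S.mem_source p))] with w hchart hlt hsource
  rw [S.chart_exp s hlt, hd] at hchart
  refine ((S.chart p).left_inv hsource).symm.trans ?_
  rw [hchart, exp]
  congr 1
  ring

theorem eventually_exp_add_eq_of_frequently [T2Space X] {s s' : Frame X} {v w : ℝ × ℝ}
    (hw : ‖w‖ < ε) (hvw : ‖v + w‖ < ε)
    (h : ∃ᶠ w₁ in 𝓝 w, ∀ᶠ w' in 𝓝 w₁, S.exp s (v + w') = S.exp s' w') :
    ∀ᶠ w' in 𝓝 w, S.exp s (v + w') = S.exp s' w' := by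
  have hcont' := S.continuousAt_exp s' hw
  have heq : S.exp s (v + w) = S.exp s' w :=
    tendsto_nhds_unique_of_frequently_eq (S.continuousAt_exp_add s hvw) hcont'
      (h.mono fun _ h' => h'.self_of_nhds)
  have hx : S.exp s' w ∈ (S.chart s.point).source := heq ▸ S.exp_mem_source s hvw
  obtain ⟨A, b, -, hAb⟩ := S.compatible s.point s'.point _ hx (S.exp_mem_source s' hw)
  have hchart : ∀ᶠ w' in 𝓝 w, S.chart s.point (S.exp s' w') = A * (s'.sign * w') + b := by
    filter_upwards [hcont'.eventually hAb, continuous_norm.continuousAt.eventually_lt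
      continuousAt_const hw] with w' hw' hlt
    rw [hw', S.chart_exp s' hlt]
  obtain ⟨w₁, hexp₁, hchart₁, hlt₁⟩ := (h.and_eventually
    (hchart.eventually_nhds.and (eventually_norm_add_lt hvw).eventually_nhds)).exists
  have haffine : ∀ᶠ w' in 𝓝 w₁, s.sign * w' + s.sign * v = A * s'.sign * w' + b := by
    filter_upwards [hexp₁, hchart₁, hlt₁] with w' hexp' hchart' hlt'
    rw [← hexp', S.chart_exp s hlt'] at hchart'
    rw [mul_assoc, ← hchart']
    ring
  obtain ⟨hsign, hshift⟩ := eq_and_eq_of_eventually_affine haffine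
  filter_upwards [hchart, hcont' ((S.chart s.point).open_source.mem_nhds hx)] with w' hw' hsource
  rw [← (S.chart s.point).left_inv hsource, hw', ← mul_assoc, ← hsign, ← hshift, exp]
  congr 1
  ring

theorem eventually_exp_add_eq [T2Space X] {s s' : Frame X} {v : ℝ × ℝ} (hv : ‖v‖ < ε)
    (h : ∀ᶠ w in 𝓝 0, S.exp s (v + w) = S.exp s' w) {w : ℝ × ℝ} (hw : ‖w‖ < ε)
    (hvw : ‖v + w‖ < ε) : ∀ᶠ w' in 𝓝 w, S.exp s (v + w') = S.exp s' w' := by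
  set W : Set (ℝ × ℝ) := Metric.ball 0 ε ∩ Metric.ball (-v) ε
  have mem_W : ∀ {w}, w ∈ W ↔ ‖w‖ < ε ∧ ‖v + w‖ < ε := by
    intro w
    simp only [W, Set.mem_inter_iff, mem_ball_iff_norm, sub_neg_eq_add, add_comm, sub_zero]
  have hW : IsPreconnected W :=
    ((convex_ball (0 : ℝ × ℝ) ε).inter (convex_ball (-v) ε)).isPreconnected
  refine hW.subset_of_closure_inter_subset isOpen_setOfPred_eventually_nhds
    ⟨0, mem_W.2 ⟨S.norm_zero_lt, by rwa [add_zero]⟩, h⟩ ?_ (mem_W.2 ⟨hw, hvw⟩)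
  rintro w₁ ⟨hclosure, hw₁⟩
  exact S.eventually_exp_add_eq_of_frequently (mem_W.1 hw₁).1 (mem_W.1 hw₁).2
    (mem_closure_iff_frequently.1 hclosure)

/-- Parallel transport of a frame along a vector of norm less than `ε`; longer vectors are given the
identity as a junk value. -/
noncomputable def translate (v : ℝ × ℝ) : Function.End (Frame X) := fun s =>
  if h : ‖v‖ < ε then (S.exists_eventually_exp_add_eq s h).choose else s

theorem exp_translate [T2Space X] (s : Frame X) {v w : ℝ × ℝ} (hv : ‖v‖ < ε) (hw : ‖w‖ < ε)
    (hvw : ‖v + w‖ < ε) : ∀ᶠ w' in 𝓝 w, S.exp s (v + w') = S.exp (S.translate v s) w' := by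
  refine S.eventually_exp_add_eq hv ?_ hw hvw
  rw [translate, dif_pos hv]
  exact (S.exists_eventually_exp_add_eq s hv).choose_spec

theorem exp_translate_zero [T2Space X] (s : Frame X) {v : ℝ × ℝ} (hv : ‖v‖ < ε) :
    ∀ᶠ w in 𝓝 0, S.exp s (v + w) = S.exp (S.translate v s) w :=
  S.exp_translate s hv S.norm_zero_lt (by rwa [add_zero])

theorem translate_eq_iff [T2Space X] (s s' : Frame X) {v : ℝ × ℝ} (hv : ‖v‖ < ε) :
    S.translate v s = s' ↔ ∀ᶠ w in 𝓝 0, S.exp s (v + w) = S.exp s' w := by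
  have hexp := S.exp_translate_zero s hv
  refine ⟨fun h => h ▸ hexp, fun h => S.eq_of_eventually_exp_eq ?_⟩
  filter_upwards [h, hexp] with w hw hw'
  rw [← hw, ← hw']

theorem point_translate [T2Space X] (s : Frame X) {v : ℝ × ℝ} (hv : ‖v‖ < ε) :
    (S.translate v s).point = S.exp s v := by
  simpa only [add_zero, exp_zero] using (S.exp_translate_zero s hv).self_of_nhds.symm

theorem isLocallyMultiplicative_translate [T2Space X] : IsLocallyMultiplicative S.translate ε := by
  intro v w hv hw hvw
  funext s
  rw [S.translate_eq_iff _ _ hvw]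
  have hexp_w := S.exp_translate s hw hv (by rwa [add_comm])
  have hexp_v := S.exp_translate_zero (S.translate w s) hv
  have htendsto : Filter.Tendsto (fun u => v + u) (𝓝 0) (𝓝 v) := by
    have : Continuous fun u : ℝ × ℝ => v + u := by fun_prop
    simpa using this.tendsto 0
  filter_upwards [htendsto.eventually hexp_w, hexp_v] with u hu hu'
  rw [add_comm v w, add_assoc, hu]
  exact hu'

theorem translate_act [T2Space X] {A : ℝ × ℝ} (hA : A * A = 1) (s : Frame X) {v : ℝ × ℝ}
    (hv : ‖v‖ < ε) : S.translate v (act A hA s) = act A hA (S.translate (A * v) s) := by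
  rw [S.translate_eq_iff _ _ hv]
  have hexp := S.exp_translate_zero s (v := A * v) (by rwa [norm_mul_of_mul_self hA])
  have htendsto : Filter.Tendsto (fun u => A * u) (𝓝 0) (𝓝 0) := by
    have : Continuous fun u : ℝ × ℝ => A * u := by fun_prop
    simpa using this.tendsto 0
  filter_upwards [htendsto.eventually hexp] with u hu
  rw [exp_act, exp_act, ← hu, mul_add]

/-- `T` is the parallel transport of frames along arbitrary vectors, extending that along short
vectors. -/
structure IsTransport (T : ℝ × ℝ → Frame X → Frame X) : Prop where
  zero : ∀ s, T 0 s = s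
  add : ∀ v w s, T (v + w) s = T w (T v s)
  act : ∀ A (hA : A * A = 1) v s, T v (act A hA s) = Frame.act A hA (T (A * v) s)
  point : ∀ v s, ‖v‖ < ε → (T v s).point = S.exp s v

theorem exists_isTransport [T2Space X] : ∃ T, S.IsTransport T := by
  obtain ⟨T, hT_mul, hT⟩ := S.isLocallyMultiplicative_translate.exists_extension S.pos
  have hzero : ∀ s, T 0 s = s := fun s => by
    rw [hT 0 S.norm_zero_lt, S.translate_eq_iff _ _ S.norm_zero_lt]
    simp
  have hadd : ∀ v w s, T (v + w) s = T w (T v s) := fun v w s => by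
    rw [add_comm]
    exact congrFun (hT_mul w v) s
  refine ⟨T, hzero, hadd, fun A hA v s => ?_, fun v s hv => ?_⟩
  · obtain ⟨n, u, hu, rfl⟩ := exists_eq_nsmul_of_norm_lt S.pos v
    induction n generalizing s with
    | zero => simp [hzero]
    | succ n ih =>
      rw [succ_nsmul, mul_add, hadd, hadd, ih, hT u hu, S.translate_act hA _ hu,
        hT (A * u) (by rwa [norm_mul_of_mul_self hA])]
  · rw [hT v hv, S.point_translate s hv]

namespace IsTransport

variable {S} {T : ℝ × ℝ → Frame X → Frame X} (hT : S.IsTransport T)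

include hT

theorem continuous_point (s : Frame X) : Continuous fun v => (T v s).point := by
  refine continuous_iff_continuousAt.2 fun v => ?_
  have hcont : ContinuousAt (fun w => S.exp (T v s) (-v + w)) v :=
    S.continuousAt_exp_add _ (by simpa using S.pos)
  refine hcont.congr ?_
  filter_upwards [eventually_norm_add_lt (v := -v) (w := v) (by simpa using S.pos)] with w hw
  rw [← hT.point _ _ hw, ← hT.add, add_neg_cancel_left]

theorem exists_forall_eq_act {s s' : Frame X} (h : s.point = s'.point) :
    ∃ A, ∃ hA : A * A = 1, ∀ w, T w s = Frame.act A hA (T (A * w) s') := by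
  obtain ⟨A, hA, rfl⟩ := exists_eq_act h
  exact ⟨A, hA, fun w => hT.act A hA w s'⟩

theorem exists_liftsOn (s : Frame X) {α : unitInterval → X} (hα : Continuous α)
    (t₀ : unitInterval) : ∃ N, IsOpen N ∧ t₀ ∈ N ∧ ∀ a b, a ≤ b → Set.Icc a b ⊆ N →
      LiftsOn (fun v => (T v s).point) α a b := by
  set ψ := S.chart (α t₀)
  have hstandard : ∀ {x}, x ∈ ψ.source → ψ x ∈ Metric.ball 0 ε →
      (T (ψ x) (standard (α t₀))).point = x := fun {x} hx hxε => by
    rw [hT.point _ _ (mem_ball_zero_iff.1 hxε), exp, standard, one_mul, ψ.left_inv hx]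
  refine ⟨α ⁻¹' (ψ.source ∩ ψ ⁻¹' Metric.ball 0 ε),
    (ψ.isOpen_inter_preimage Metric.isOpen_ball).preimage hα,
    ⟨S.mem_source _, by simpa [ψ, S.apply_self] using S.pos⟩, fun a b hab hN v₀ hv₀ => ?_⟩
  have ha := hN ⟨le_rfl, hab⟩
  obtain ⟨A, hA, hact⟩ := hT.exists_forall_eq_act (hv₀.trans (hstandard ha.1 ha.2).symm)
  refine ⟨fun t => v₀ + A * (ψ (α t) - ψ (α a)), ?_, by simp, fun t ht => ?_⟩
  · have hψα : ContinuousOn (fun t => ψ (α t)) (Set.Icc a b) :=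
      ψ.continuousOn.comp hα.continuousOn fun t ht => (hN ht).1
    exact continuousOn_const.add (continuousOn_const.mul (hψα.sub continuousOn_const))
  · simp only [hT.add v₀, hact, ← mul_assoc, hA, one_mul, ← hT.add (ψ (α a)), add_sub_cancel]
    exact hstandard (hN ht).1 (hN ht).2

end IsTransport

include S in
theorem exists_developing [T2Space X] (p : X) : ∃ E : ℝ × ℝ → X, Continuous E ∧ E 0 = p ∧
    (∀ v₀ v₁, E v₀ = E v₁ → ∃ A : ℝ × ℝ, A * A = 1 ∧ ∀ w, E (v₁ + w) = E (v₀ + A * w)) ∧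
    ∀ α : C(unitInterval, X), α 0 = p → ∃ v : unitInterval → ℝ × ℝ, Continuous v ∧ v 0 = 0 ∧
      ∀ t, E (v t) = α t := by
  obtain ⟨T, hT⟩ := S.exists_isTransport
  have hzero : (T 0 (standard p)).point = p := congrArg Frame.point (hT.zero _)
  refine ⟨fun v => (T v (standard p)).point, hT.continuous_point _, hzero, fun v₀ v₁ h => ?_,
    fun α hα => exists_continuous_lift_of_liftsOn (hT.exists_liftsOn _ α.continuous)
      (hzero.trans hα.symm)⟩
  obtain ⟨A, hA, hact⟩ := hT.exists_forall_eq_act h.symm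
  exact ⟨A, hA, fun w => by simp only [hT.add, hact, Frame.act]⟩

end FlatStructure

section Windings

open Complex

theorem eq_zero_of_norm_intCast_mul_lt {c : ℂ} {k : ℤ} (h : ‖(k : ℂ) * c‖ < ‖c‖) : k = 0 := by
  have hc : 0 < ‖c‖ := (norm_nonneg _).trans_lt h
  rw [norm_mul, norm_intCast, mul_lt_iff_lt_one_left hc, ← Int.cast_abs] at h
  exact Int.abs_lt_one_iff.1 (by exact_mod_cast h)

theorem sub_eq_sub_of_exp_eq {T : Type*} [TopologicalSpace T] [PreconnectedSpace T] {u v : T → ℂ}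
    (hu : Continuous u) (hv : Continuous v) (h : ∀ t, exp (u t) = exp (v t)) (s t : T) :
    u s - v s = u t - v t := by
  refine isPreconnected_univ.induction₂ (s := Set.univ) (fun s t => u s - v s = u t - v t)
    (fun x _ => ?_) (fun _ _ _ _ _ _ => Eq.trans) (fun _ _ _ _ => Eq.symm) trivial trivial
  rw [nhdsWithin_univ]
  have hc : ContinuousAt (fun y => ‖(u x - v x) - (u y - v y)‖) x := by fun_prop
  filter_upwards [hc.eventually_lt (g := fun _ => ‖2 * Real.pi * I‖) continuousAt_const
    (by simp [Real.pi_ne_zero])] with y hy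
  obtain ⟨n, hn⟩ := exp_eq_exp_iff_exists_int.1 (h x)
  obtain ⟨m, hm⟩ := exp_eq_exp_iff_exists_int.1 (h y)
  have hdiff : (u x - v x) - (u y - v y) = ((n - m : ℤ) : ℂ) * (2 * Real.pi * I) := by
    rw [hn, hm]
    push_cast
    ring
  rw [hdiff] at hy
  rwa [eq_zero_of_norm_intCast_mul_lt hy, Int.cast_zero, zero_mul, sub_eq_zero] at hdiff

theorem exists_continuous_exp_eq {Y : Type*} [TopologicalSpace Y] [SimplyConnectedSpace Y]
    [LocallyPathConnectedSpace Y] {f : Y → ℂ} (hf : Continuous f) (hf0 : ∀ y, f y ≠ 0) :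
    ∃ h : Y → ℂ, Continuous h ∧ ∀ y, exp (h y) = f y := by
  obtain ⟨y₀⟩ : Nonempty Y := inferInstance
  obtain ⟨h, ⟨-, hh⟩, -⟩ := isCoveringMapOn_exp.existsUnique_continuousMap_lifts
    ⟨f, hf⟩ (a₀ := y₀) (exp_log (hf0 y₀)) hf0
  exact ⟨h, h.continuous, congrFun hh⟩

variable {V ι : Type*} [NormedAddCommGroup V] [NormedSpace ℝ V] [FiniteDimensional ℝ V] [Fintype ι]

theorem exists_small_int_combination (γ : ι → V) (hι : Module.finrank ℝ V < Fintype.card ι)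
    {δ : ℝ} (hδ : 0 < δ) : ∃ n : ι → ℤ, n ≠ 0 ∧ ‖∑ m, n m • γ m‖ < δ := by
  by_contra! hcon
  have eq_zero : ∀ n : ι → ℤ, ‖∑ m, n m • γ m‖ < δ → n = 0 := fun n hn =>
    by_contra fun hn0 => (hcon n hn0).not_gt hn
  have hli : LinearIndependent ℤ γ := Fintype.linearIndependent_iff.2 fun n hn =>
    congrFun (eq_zero n (by rwa [hn, norm_zero]))
  have hdiscrete : DiscreteTopology (Submodule.span ℤ (Set.range γ)) := by
    refine discreteTopology_of_isOpen_singleton_zero (Metric.isOpen_singleton_iff.2 ⟨δ, hδ, ?_⟩)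
    rintro ⟨y, hy⟩ hyδ
    obtain ⟨n, rfl⟩ := (Submodule.mem_span_range_iff_exists_fun ℤ).1 hy
    rw [Subtype.dist_eq, Submodule.coe_zero, dist_zero_right] at hyδ
    simp [eq_zero n hyδ]
  have hfinrank := Real.finrank_eq_int_finrank_of_discrete hdiscrete
  rw [Set.finrank, Set.finrank, finrank_span_eq_card hli] at hfinrank
  exact hι.not_ge (hfinrank ▸ Submodule.finrank_le _)

/-- The translations `γ` together with the increments `z` that they produce in the functions
`h j`. -/
def quasiPeriods {V ι : Type*} [AddCommGroup V] (h : ι → V → ℂ) : AddSubgroup (V × (ι → ℂ)) where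
  carrier := {x | ∀ j v, h j (v + x.1) = h j v + x.2 j}
  zero_mem' := fun j v => by simp
  add_mem' := fun {x y} hx hy j v => by
    rw [Prod.fst_add, Prod.snd_add, ← add_assoc, hy, hx, Pi.add_apply, add_assoc]
  neg_mem' := fun {x} hx j v => by
    have := hx j (v + -x.1)
    rw [neg_add_cancel_right] at this
    rw [Prod.fst_neg, Prod.snd_neg, Pi.neg_apply, this, add_neg_cancel_right]

theorem det_eq_zero_of_mem_quasiPeriods [DecidableEq ι] {h : ι → V → ℂ}
    (hι : Module.finrank ℝ V < Fintype.card ι) (hc : ∀ j, ContinuousAt (h j) 0) {c : ℂ}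
    (hc0 : c ≠ 0) (M : Matrix ι ι ℤ) {γ : ι → V}
    (hγ : ∀ m, (γ m, fun j => M m j * c) ∈ quasiPeriods h) :
    M.det = 0 := by
  have hclose : ∀ᶠ v in 𝓝 (0 : V), ∀ j, ‖h j v - h j 0‖ < ‖c‖ := by
    refine Filter.eventually_all.2 fun j => ?_
    have hcj : ContinuousAt (fun v => ‖h j v - h j 0‖) 0 := ((hc j).sub continuousAt_const).norm
    exact hcj.eventually_lt continuousAt_const (by simpa using hc0)
  obtain ⟨δ, hδ, hδh⟩ := Metric.eventually_nhds_iff.1 hclose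
  obtain ⟨n, hn0, hn⟩ := exists_small_int_combination γ hι hδ
  have hsum : ∀ j, h j (∑ m, n m • γ m) = h j 0 + ∑ m, (n m : ℂ) * (M m j * c) := fun j => by
    have hmem : ∑ m, n m • (γ m, fun j => M m j * c) ∈ quasiPeriods h :=
      AddSubgroup.sum_mem _ fun m _ => AddSubgroup.zsmul_mem _ (hγ m) (n m)
    simpa [Prod.fst_sum, Prod.snd_sum] using hmem j 0
  refine (Matrix.exists_vecMul_eq_zero_iff).1 ⟨n, hn0, funext fun j => ?_⟩
  refine eq_zero_of_norm_intCast_mul_lt (c := c) ?_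
  have hj := hδh (y := ∑ m, n m • γ m) (by rwa [dist_zero_right]) j
  rw [hsum, add_sub_cancel_left] at hj
  simpa only [Matrix.vecMul, dotProduct, Int.cast_sum, Int.cast_mul, Finset.sum_mul,
    mul_assoc] using hj

theorem FlatStructure.det_windings_eq_zero {X : Type*} [TopologicalSpace X] [T2Space X] {ε : ℝ}
    (S : FlatStructure X ε) [DecidableEq ι] (hι : 2 < Fintype.card ι) {p : X} {w : ι → X → ℂ}
    (hw : ∀ j, Continuous (w j)) (hw0 : ∀ j x, w j x ≠ 0) {α : ι → C(unitInterval, X)}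
    (hα0 : ∀ m, α m 0 = p) (hα1 : ∀ m, α m 1 = p) {L : ι → ι → unitInterval → ℂ}
    (hL : ∀ m j, Continuous (L m j)) (hexp : ∀ m j t, Complex.exp (L m j t) = w j (α m t))
    (M : Matrix ι ι ℤ) (hM : ∀ m j, L m j 1 - L m j 0 = M m j * (2 * Real.pi * I)) :
    M.det = 0 := by
  obtain ⟨E, hE, hE0, hE_eq, hE_lift⟩ := S.exists_developing p
  choose h hh hh_exp using fun j => exists_continuous_exp_eq ((hw j).comp hE) fun v => hw0 j (E v)
  have hdeck : ∀ m, ∃ A b : ℝ × ℝ, A * A = 1 ∧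
      ∀ j u, h j (b + A * u) = h j u + M m j * (2 * Real.pi * I) := by
    intro m
    obtain ⟨v, hv, hv0, hvE⟩ := hE_lift (α m) (hα0 m)
    obtain ⟨A, hA, hAE⟩ := hE_eq 0 (v 1) (by rw [hE0, hvE, hα1])
    refine ⟨A, v 1, hA, fun j u => ?_⟩
    have hdeck_j := sub_eq_sub_of_exp_eq (u := fun u => h j (v 1 + A * u)) (v := h j)
      ((hh j).comp (by fun_prop)) (hh j)
      (fun u => by simp [hh_exp, hAE, ← mul_assoc, hA]) u 0
    have hloop := sub_eq_sub_of_exp_eq (u := fun t => h j (v t)) (v := L m j)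
      ((hh j).comp hv) (hL m j) (fun t => by simp [hh_exp, hexp, hvE]) 1 0
    simp only [mul_zero, add_zero] at hdeck_j
    rw [hv0] at hloop
    linear_combination hdeck_j + hloop + hM m j
  choose A b hA hb using hdeck
  -- The square of `u ↦ b + A * u` is a translation, because `A * A = 1`.
  refine det_eq_zero_of_mem_quasiPeriods (γ := fun m => b m + A m * b m) (by simpa using hι)
    (fun j => (hh j).continuousAt) (mul_ne_zero two_ne_zero two_pi_I_ne_zero) M fun m j u => ?_
  have hsq : u + (b m + A m * b m) = b m + A m * (b m + A m * u) := by
    rw [mul_add, ← mul_assoc, hA, one_mul]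
    ring
  simp only [hsq, hb]
  ring

end Windings

/-- Along the filter `l`, the planar coordinates `u` and `v` agree up to a translation and up to
reflections in the axes. -/
def FlatAlong {X : Type*} (l : Filter X) (u v : X → ℝ × ℝ) : Prop :=
  AffineAlong 1 l (fun x => (u x).1) (fun x => (v x).1) ∧
    AffineAlong 1 l (fun x => (u x).2) (fun x => (v x).2)

namespace FlatAlong

variable {X : Type*} {l : Filter X} {u v w : X → ℝ × ℝ}

theorem symm (h : FlatAlong l u v) : FlatAlong l v u :=
  ⟨inv_one (G := ℝ) ▸ h.1.symm one_ne_zero, inv_one (G := ℝ) ▸ h.2.symm one_ne_zero⟩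

theorem trans (h : FlatAlong l u v) (h' : FlatAlong l v w) : FlatAlong l u w :=
  ⟨one_mul (1 : ℝ) ▸ h.1.trans h'.1, one_mul (1 : ℝ) ▸ h.2.trans h'.2⟩

theorem add_const (l : Filter X) (u : X → ℝ × ℝ) (c : ℝ × ℝ) : FlatAlong l (fun x => u x + c) u :=
  ⟨⟨1, c.1, by simp⟩, ⟨1, c.2, by simp⟩⟩

theorem exists_eventually_eq (h : FlatAlong l u v) :
    ∃ A b : ℝ × ℝ, A * A = 1 ∧ ∀ᶠ x in l, u x = A * v x + b := by
  obtain ⟨⟨ε, b, hε, h⟩, ε', b', hε', h'⟩ := h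
  refine ⟨(ε, ε'), (b, b'), ?_, ?_⟩
  · rcases hε with rfl | rfl <;> rcases hε' with rfl | rfl <;> simp
  · filter_upwards [h, h'] with x hx hx'
    rw [one_mul] at hx hx'
    exact Prod.ext hx hx'

end FlatAlong

namespace SingularMeasuredFoliation

variable {X : Type*} [TopologicalSpace X] {F G : SingularMeasuredFoliation X}
  {φ ψ : OpenPartialHomeomorph X (ℝ × ℝ)}

theorem IsPairChart.flatAlong (hφ : IsPairChart F G φ) (hψ : IsPairChart F G ψ) {x : X}
    (hxφ : x ∈ φ.source) (hxψ : x ∈ ψ.source) : FlatAlong (𝓝 x) φ ψ :=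
  ⟨hφ.affineAlong_fst hψ hxφ hxψ, affineAlong_charts hφ.1 hψ.1 hxφ hxψ⟩

theorem IsPairChart.flatAlong_of_hasImage {g : X → X} (hF : F.HasImage g 1 F)
    (hG : G.HasImage g 1 G) (hφ : IsPairChart F G φ) (hψ : IsPairChart F G ψ) {x : X}
    (hxφ : x ∈ φ.source) (hxψ : g x ∈ ψ.source) : FlatAlong (𝓝 x) φ (fun x' => ψ (g x')) :=
  ⟨hG.affineAlong hφ.2 hψ.2 hxφ hxψ, hF.affineAlong hφ.1 hψ.1 hxφ hxψ⟩

/-- A chart whose coordinates are those of the common charts of `F` and `G`, up to signs and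
translations. -/
def IsFlatChart (F G : SingularMeasuredFoliation X) (φ : OpenPartialHomeomorph X (ℝ × ℝ)) : Prop :=
  ∀ x ∈ φ.source, ∀ ψ, IsPairChart F G ψ → x ∈ ψ.source → FlatAlong (𝓝 x) φ ψ

/-- There is a flat chart centred at `p` that contains a square of side `2 δ`. -/
def HasFlatBox (F G : SingularMeasuredFoliation X) (δ : ℝ) (p : X) : Prop :=
  ∃ φ, IsFlatChart F G φ ∧ p ∈ φ.source ∧ φ p = 0 ∧ Metric.ball 0 δ ⊆ φ.target

theorem HasFlatBox.mono {δ δ' : ℝ} {p : X} (h : HasFlatBox F G δ p) (hδ : δ' ≤ δ) :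
    HasFlatBox F G δ' p := by
  obtain ⟨φ, hφ, hpφ, hφp, hball⟩ := h
  exact ⟨φ, hφ, hpφ, hφp, (Metric.ball_subset_ball hδ).trans hball⟩

theorem IsPairChart.hasFlatBox (hφ : IsPairChart F G φ) {p : X} (hp : p ∈ φ.source) {δ : ℝ}
    (hball : Metric.ball (φ p) δ ⊆ φ.target) : HasFlatBox F G δ p := by
  refine ⟨φ.transHomeomorph (Homeomorph.addRight (-φ p)), fun x hx ψ hψ hxψ => ?_, hp, by simp,
    fun v hv => hball ?_⟩
  · exact (FlatAlong.add_const _ _ _).trans (hφ.flatAlong hψ hx hxψ)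
  · change v + - -φ p ∈ _
    simpa [Metric.mem_ball, dist_eq_norm] using hv

theorem Transverse.eventually_hasFlatBox (h : F.Transverse G) {p : X} (hp : p ∉ F.sing) :
    ∃ δ > 0, ∀ᶠ p' in 𝓝 p, HasFlatBox F G δ p' := by
  obtain ⟨φ, hφ, hpφ, hφ'⟩ := h.regular p hp
  obtain ⟨r, hr, hrφ⟩ := Metric.isOpen_iff.1 φ.open_target _ (φ.map_source hpφ)
  refine ⟨r / 2, half_pos hr, ?_⟩
  filter_upwards [φ.open_source.mem_nhds hpφ,
    φ.continuousAt hpφ (Metric.ball_mem_nhds _ (half_pos hr))] with p' hp' hdist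
  exact IsPairChart.hasFlatBox ⟨hφ, hφ'⟩ hp'
    ((Metric.ball_subset_ball' (by linarith [Metric.mem_ball.1 hdist])).trans hrφ)

theorem HasFlatBox.of_homeomorph (h : F.Transverse G) {g : X ≃ₜ X} (hF : F.HasImage g 1 F)
    (hG : G.HasImage g 1 G) {δ : ℝ} {p : X} (hp : HasFlatBox F G δ (g p)) : HasFlatBox F G δ p := by
  obtain ⟨φ, hφ, hpφ, hφp, hball⟩ := hp
  refine ⟨g.transOpenPartialHomeomorph φ, fun x hx ψ hψ hxψ => ?_, hpφ, hφp, hball⟩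
  obtain ⟨χ, hχ, hxχ, hχ'⟩ := h.regular (g x) fun hsing =>
    F.source_subset ψ hψ.1 hxψ ((hF.mem_sing_iff x).1 hsing)
  obtain ⟨hfst, hsnd⟩ := hφ (g x) hx χ ⟨hχ, hχ'⟩ hxχ
  have hφχ : FlatAlong (𝓝 x) (g.transOpenPartialHomeomorph φ) (fun x' => χ (g x')) :=
    ⟨hfst.comp g.continuous.continuousAt, hsnd.comp g.continuous.continuousAt⟩
  exact hφχ.trans (hψ.flatAlong_of_hasImage hF hG ⟨hχ, hχ'⟩ hxψ hxχ).symm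

theorem Transverse.exists_hasFlatBox_of_isCompact (h : F.Transverse G) (hs : F.sing = ∅)
    {K : Set X} (hK : IsCompact K) : ∃ ε > 0, ∀ p ∈ K, HasFlatBox F G ε p := by
  refine hK.induction_on (p := fun S => ∃ ε > 0, ∀ p ∈ S, HasFlatBox F G ε p)
    ⟨1, one_pos, by simp⟩ ?_ ?_ fun p _ => ?_
  · rintro S T hST ⟨ε, hε, hT⟩
    exact ⟨ε, hε, fun p hp => hT p (hST hp)⟩
  · rintro S T ⟨ε, hε, hS⟩ ⟨ε', hε', hT⟩
    refine ⟨min ε ε', lt_min hε hε', ?_⟩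
    rintro p (hp | hp)
    · exact (hS p hp).mono (min_le_left _ _)
    · exact (hT p hp).mono (min_le_right _ _)
  · obtain ⟨δ, hδ, hbox⟩ := h.eventually_hasFlatBox (p := p) (by simp [hs])
    exact ⟨_, nhdsWithin_le_nhds hbox, δ, hδ, fun p hp => hp⟩

theorem Transverse.exists_flatStructure (h : F.Transverse G) (hs : F.sing = ∅) {K : Set X}
    (hK : IsCompact K)
    (hg : ∀ x : X, ∃ g : X ≃ₜ X, g x ∈ K ∧ F.HasImage g 1 F ∧ G.HasImage g 1 G) :
    ∃ ε, Nonempty (FlatStructure X ε) := by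
  obtain ⟨ε, hε, hεK⟩ := h.exists_hasFlatBox_of_isCompact hs hK
  have hbox : ∀ p, HasFlatBox F G ε p := fun p => by
    obtain ⟨g, hgK, hF, hG⟩ := hg p
    exact (hεK _ hgK).of_homeomorph h hF hG
  choose φ hφ hmem hself hball using hbox
  refine ⟨ε, ⟨hε, φ, hmem, hself, hball, fun p q x hxp hxq => ?_⟩⟩
  obtain ⟨χ, hχ, hxχ, hχ'⟩ := h.regular x (by simp [hs])
  exact ((hφ p x hxp χ ⟨hχ, hχ'⟩ hxχ).trans
    (hφ q x hxq χ ⟨hχ, hχ'⟩ hxχ).symm).exists_eventually_eq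

end SingularMeasuredFoliation

/-! ### Winding numbers around the holes of the ladder -/

theorem quarter_le_mul_add_cos_sq_of_le_half {d e : ℝ} (hd : 0 ≤ d) (hd' : d ≤ 1 / 2)
    (hde : 1 ≤ d + e) : 1 / 4 ≤ d * e + Real.cos (Real.pi * d) ^ 2 := by
  have hcos : 1 - 2 * d ≤ Real.cos (Real.pi * d) := by
    convert Real.one_sub_mul_le_cos (x := Real.pi * d) (by positivity)
      (by nlinarith [Real.pi_pos]) using 1
    field_simp
  have hcos_sq : (1 - 2 * d) ^ 2 ≤ Real.cos (Real.pi * d) ^ 2 :=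
    pow_le_pow_left₀ (by linarith) hcos 2
  have hmul : d * (1 - d) ≤ d * e := mul_le_mul_of_nonneg_left (by linarith) hd
  nlinarith [sq_nonneg (d - 1 / 2)]

theorem quarter_le_mul_add_cos_sq {d e : ℝ} (hd : 0 ≤ d) (he : 0 ≤ e) {m : ℕ}
    (hde : d + e = m + 1) : 1 / 4 ≤ d * e + Real.cos (Real.pi * d) ^ 2 := by
  have hsymm : Real.cos (Real.pi * d) ^ 2 = Real.cos (Real.pi * e) ^ 2 := by
    have hd_eq : Real.pi * d = ((m + 1 : ℕ) : ℝ) * Real.pi - Real.pi * e := by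
      push_cast
      rw [← hde]
      ring
    rw [hd_eq, Real.cos_nat_mul_pi_sub, mul_pow, ← pow_mul, mul_comm (m + 1), pow_mul,
      neg_one_sq, one_pow, one_mul]
  have hm_nonneg : (0 : ℝ) ≤ m := Nat.cast_nonneg m
  rcases le_total d (1 / 2) with hd' | hd'
  · exact quarter_le_mul_add_cos_sq_of_le_half hd hd' (by linarith [hm_nonneg])
  rcases le_total e (1 / 2) with he' | he'
  · rw [hsymm, mul_comm]
    exact quarter_le_mul_add_cos_sq_of_le_half he he' (by linarith [hm_nonneg])
  · nlinarith [sq_nonneg (Real.cos (Real.pi * d)), hm_nonneg]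

theorem quarter_le_on_circle (m : ℕ) (θ : ℝ) :
    1 / 4 ≤ ((m + 1) / 2 * Real.sin θ) ^ 2 +
      Real.sin (Real.pi * (m / 2 - (m + 1) / 2 * Real.cos θ)) ^ 2 := by
  -- The projection of the point cuts the horizontal diameter into pieces of lengths `d` and `e`.
  set d : ℝ := (m + 1) / 2 * (1 - Real.cos θ) with hd
  set e : ℝ := (m + 1) / 2 * (1 + Real.cos θ) with he
  have hd0 : 0 ≤ d := mul_nonneg (by positivity) (by linarith [Real.cos_le_one θ])
  have he0 : 0 ≤ e := mul_nonneg (by positivity) (by linarith [Real.neg_one_le_cos θ])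
  have hy : ((m + 1) / 2 * Real.sin θ) ^ 2 = d * e := by
    rw [mul_pow, Real.sin_sq, hd, he]
    ring
  have hx : Real.pi * (m / 2 - (m + 1) / 2 * Real.cos θ) = Real.pi * d - Real.pi / 2 := by
    rw [hd]
    ring
  rw [hy, hx, Real.sin_sub_pi_div_two, neg_sq]
  exact quarter_le_mul_add_cos_sq hd0 he0 (m := m) (by rw [hd, he]; ring)

/-- The point of the ladder above `(x, y)` with nonnegative third coordinate. -/
noncomputable def upperSheet (x y : ℝ)
    (h : 0 ≤ (4 - y ^ 2) * (y ^ 2 + Real.sin (Real.pi * x) ^ 2 - 1 / 4)) : Ladder :=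
  ⟨(x, y, √((4 - y ^ 2) * (y ^ 2 + Real.sin (Real.pi * x) ^ 2 - 1 / 4))), Real.sq_sqrt h⟩

theorem holeLoop_radicand_nonneg (m : Fin 3) (θ : ℝ) :
    0 ≤ (4 - (-((m + 1) / 2 * Real.sin θ)) ^ 2) *
      ((-((m + 1) / 2 * Real.sin θ)) ^ 2 +
        Real.sin (Real.pi * (m / 2 - (m + 1) / 2 * Real.cos θ)) ^ 2 - 1 / 4) := by
  rw [neg_sq]
  refine mul_nonneg ?_ (sub_nonneg.2 (quarter_le_on_circle m θ))
  have hm : (m : ℝ) ≤ 2 := by exact_mod_cast Nat.le_of_lt_succ m.2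
  have hradius : ((m + 1) / 2 : ℝ) ^ 2 ≤ 4 := by nlinarith [(m : ℕ).cast_nonneg (α := ℝ)]
  have hy := mul_le_mul hradius (Real.sin_sq_le_one θ) (sq_nonneg _) (by norm_num)
  rw [mul_pow]
  linarith

/-- The loop on the upper half of the ladder over the circle in the plane that starts at `(-1/2, 0)`
and runs around the holes at `0, …, m`. Three of these loops suffice, because the developing map
takes values in a plane. -/
noncomputable def holeLoop (m : Fin 3) : C(unitInterval, Ladder) where
  toFun t := upperSheet (m / 2 - (m + 1) / 2 * Real.cos (2 * Real.pi * t))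
    (-((m + 1) / 2 * Real.sin (2 * Real.pi * t))) (holeLoop_radicand_nonneg m (2 * Real.pi * t))
  continuous_toFun := Continuous.subtype_mk (by fun_prop) _

theorem holeLoop_zero (m : Fin 3) : holeLoop m 0 = holeLoop 0 0 := by
  have hstart : (m : ℝ) / 2 - (m + 1) / 2 = -(1 / 2) := by ring
  apply Subtype.ext
  simp [holeLoop, upperSheet, hstart]

theorem holeLoop_one (m : Fin 3) : holeLoop m 1 = holeLoop 0 0 := by
  rw [← holeLoop_zero m]
  apply Subtype.ext
  simp [holeLoop, upperSheet]

/-- The projection of the ladder to the plane, seen from the `j`-th hole. -/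
def holeCoord (j : Fin 3) (v : Ladder) : ℂ := ⟨v.1.1 - (j : ℕ), v.1.2.1⟩

theorem continuous_holeCoord (j : Fin 3) : Continuous (holeCoord j) :=
  Complex.equivRealProdCLM.symm.continuous.comp
    (f := fun v : Ladder => (v.1.1 - (j : ℕ), v.1.2.1)) (by fun_prop)

theorem holeCoord_ne_zero (j : Fin 3) (v : Ladder) : holeCoord j v ≠ 0 := by
  intro h
  have hx : v.1.1 - (j : ℕ) = 0 := congrArg Complex.re h
  have hy : v.1.2.1 = 0 := congrArg Complex.im h
  have hz : v.1.2.2 ^ 2 =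
      (4 - v.1.2.1 ^ 2) * (v.1.2.1 ^ 2 + Real.sin (Real.pi * v.1.1) ^ 2 - 1 / 4) := v.2
  rw [sub_eq_zero.1 hx, hy, mul_comm Real.pi, Real.sin_nat_mul_pi] at hz
  nlinarith [sq_nonneg v.1.2.2]

theorem holeCoord_holeLoop (m j : Fin 3) (t : unitInterval) :
    holeCoord j (holeLoop m t) = ((m / 2 - j : ℝ) : ℂ) -
      (((m + 1) / 2 : ℝ) : ℂ) * Complex.exp ((2 * Real.pi * t : ℝ) * Complex.I) := by
  rw [Complex.exp_mul_I, ← Complex.ofReal_cos, ← Complex.ofReal_sin]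
  apply Complex.ext
  · rw [Complex.sub_re, Complex.re_ofReal_mul, Complex.add_re, Complex.ofReal_re, Complex.ofReal_re,
      Complex.re_ofReal_mul, Complex.I_re]
    simp only [holeCoord, holeLoop, upperSheet, ContinuousMap.coe_mk]
    ring
  · rw [Complex.sub_im, Complex.im_ofReal_mul, Complex.add_im, Complex.ofReal_im, Complex.ofReal_im,
      Complex.im_ofReal_mul, Complex.I_im]
    simp only [holeCoord, holeLoop, upperSheet, ContinuousMap.coe_mk]
    ring

theorem exists_log_circle_of_abs_lt_radius {a ρ : ℝ} (h : |a| < ρ) :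
    ∃ L : unitInterval → ℂ, Continuous L ∧ L 1 - L 0 = 2 * Real.pi * Complex.I ∧
      ∀ t : unitInterval,
        Complex.exp (L t) = a - ρ * Complex.exp ((2 * Real.pi * t : ℝ) * Complex.I) := by
  have hρ : 0 < ρ := (abs_nonneg a).trans_lt h
  have hρ' : (ρ : ℂ) ≠ 0 := Complex.ofReal_ne_zero.2 hρ.ne'
  let u (t : unitInterval) : ℂ :=
    -((a / ρ : ℝ) : ℂ) * Complex.exp ((-(2 * Real.pi * t) : ℝ) * Complex.I)
  have hu : ∀ t, 1 + u t ∈ Complex.slitPlane := fun t => by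
    refine Complex.mem_slitPlane_of_norm_lt_one ?_
    rw [norm_mul, Complex.norm_exp_ofReal_mul_I, mul_one, norm_neg, Complex.norm_real,
      Real.norm_eq_abs, abs_div, abs_of_pos hρ, div_lt_one hρ]
    exact h
  have hu_closed : u 1 = u 0 := by simp [u, Complex.exp_neg]
  have hlog : Continuous fun t => Complex.log (1 + u t) := Continuous.clog (by fun_prop) hu
  refine ⟨fun t => Complex.log (-ρ) + (2 * Real.pi * t : ℝ) * Complex.I + Complex.log (1 + u t),
    by fun_prop, by simp [hu_closed], fun t => ?_⟩
  rw [Complex.exp_add, Complex.exp_add, Complex.exp_log (neg_ne_zero.2 hρ'),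
    Complex.exp_log (Complex.slitPlane_ne_zero (hu t))]
  have hexp := Complex.exp_ne_zero ((2 * Real.pi * t : ℝ) * Complex.I)
  simp only [u, Complex.ofReal_neg, neg_mul, Complex.exp_neg, Complex.ofReal_div]
  field_simp
  ring

theorem exists_log_circle_of_radius_lt_abs {a ρ : ℝ} (hρ : 0 < ρ) (h : ρ < |a|) :
    ∃ L : unitInterval → ℂ, Continuous L ∧ L 1 - L 0 = 0 ∧
      ∀ t : unitInterval,
        Complex.exp (L t) = a - ρ * Complex.exp ((2 * Real.pi * t : ℝ) * Complex.I) := by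
  have ha : a ≠ 0 := abs_pos.1 (hρ.trans h)
  have ha' : (a : ℂ) ≠ 0 := Complex.ofReal_ne_zero.2 ha
  let u (t : unitInterval) : ℂ :=
    -((ρ / a : ℝ) : ℂ) * Complex.exp ((2 * Real.pi * t : ℝ) * Complex.I)
  have hu : ∀ t, 1 + u t ∈ Complex.slitPlane := fun t => by
    refine Complex.mem_slitPlane_of_norm_lt_one ?_
    rw [norm_mul, Complex.norm_exp_ofReal_mul_I, mul_one, norm_neg, Complex.norm_real,
      Real.norm_eq_abs, abs_div, abs_of_pos hρ, div_lt_one (abs_pos.2 ha)]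
    exact h
  have hu_closed : u 1 = u 0 := by simp [u]
  have hlog : Continuous fun t => Complex.log (1 + u t) := Continuous.clog (by fun_prop) hu
  refine ⟨fun t => Complex.log a + Complex.log (1 + u t), by fun_prop, by simp [hu_closed],
    fun t => ?_⟩
  rw [Complex.exp_add, Complex.exp_log ha', Complex.exp_log (Complex.slitPlane_ne_zero (hu t))]
  simp only [u, Complex.ofReal_div]
  field_simp
  ring

/-- The winding number of the `m`-th hole loop around the `j`-th hole. -/
def holeWinding : Matrix (Fin 3) (Fin 3) ℤ := Matrix.of fun m j => if j ≤ m then 1 else 0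

theorem det_holeWinding : holeWinding.det = 1 := by decide

theorem exists_log_holeLoop (m j : Fin 3) : ∃ L : unitInterval → ℂ, Continuous L ∧
    L 1 - L 0 = holeWinding m j * (2 * Real.pi * Complex.I) ∧
    ∀ t, Complex.exp (L t) = holeCoord j (holeLoop m t) := by
  simp only [holeCoord_holeLoop, holeWinding, Matrix.of_apply]
  have hm : (0 : ℝ) ≤ m := Nat.cast_nonneg _
  have hj : (0 : ℝ) ≤ j := Nat.cast_nonneg _
  split_ifs with h
  · have hjm : (j : ℝ) ≤ m := by exact_mod_cast h
    rw [Int.cast_one, one_mul]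
    exact exists_log_circle_of_abs_lt_radius (abs_lt.2 ⟨by linarith, by linarith [hj]⟩)
  · have hmj : (m : ℝ) + 1 ≤ j := by exact_mod_cast not_le.1 h
    rw [Int.cast_zero, zero_mul]
    refine exists_log_circle_of_radius_lt_abs (by positivity) ?_
    rw [abs_of_neg (by linarith [hm])]
    linarith

theorem isEmpty_flatStructure_ladder (ε : ℝ) : IsEmpty (FlatStructure Ladder ε) := by
  refine ⟨fun S => ?_⟩
  choose L hL hwinding hexp using exists_log_holeLoop
  have hdet := S.det_windings_eq_zero (by simp) continuous_holeCoord holeCoord_ne_zero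
    holeLoop_zero holeLoop_one hL hexp holeWinding hwinding
  simp [det_holeWinding] at hdet

/-! ### Foliations lifted to the ladder -/

namespace SingularMeasuredFoliation

variable {X Y : Type*} [TopologicalSpace X] [TopologicalSpace Y]
  {F G : SingularMeasuredFoliation Y} {q : X → Y} {K : Set X}

theorem Transverse.isArational_lift [T3Space X] (h : F.Transverse G) (hq : IsLocalHomeomorph q)
    (hK : IsCompact K) (hdeck : ∀ x, ∃ τ : X ≃ₜ X, (∀ y, q (τ y) = q y) ∧ τ x ∈ K)
    {e : X ≃ₜ X} {c : ℝ} (hc₀ : 0 < c) (hc₁ : c < 1)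
    (hF : (F.lift hq).HasImage e c (F.lift hq)) (hG : (G.lift hq).HasImage e c⁻¹ (G.lift hq)) :
    (F.lift hq).IsArational := by
  refine isArational_of_contracting (h.lift hq) hK hc₀ hc₁ fun n x => ?_
  obtain ⟨τ, hτ, hτK⟩ := hdeck ((e ^ n) x)
  refine ⟨(e ^ n).trans τ, hτK, ?_, ?_⟩
  · rw [← mul_one (c ^ n)]
    exact (hF.pow n).comp (hasImage_lift_deck hq F hτ) (e ^ n).continuous
  · rw [← inv_pow, ← mul_one (c⁻¹ ^ n)]
    exact (hG.pow n).comp (hasImage_lift_deck hq G hτ) (e ^ n).continuous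

theorem Transverse.nonempty_sing_lift (h : F.Transverse G) (hq : IsLocalHomeomorph q)
    (hK : IsCompact K) (hdeck : ∀ x, ∃ τ : X ≃ₜ X, (∀ y, q (τ y) = q y) ∧ τ x ∈ K)
    (hflat : ∀ ε, IsEmpty (FlatStructure X ε)) : (F.lift hq).sing.Nonempty := by
  refine Set.nonempty_iff_ne_empty.2 fun hs => ?_
  obtain ⟨ε, ⟨S⟩⟩ := (h.lift hq).exists_flatStructure hs hK fun x => by
    obtain ⟨τ, hτ, hτK⟩ := hdeck x
    exact ⟨τ, hτK, hasImage_lift_deck hq F hτ, hasImage_lift_deck hq G hτ⟩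
  exact (hflat ε).false S

end SingularMeasuredFoliation

theorem handleShift_zpow (k n : ℤ) : handleShift k ^ n = handleShift (n * k) := by
  let shiftHom : Multiplicative ℤ →* (Ladder ≃ₜ Ladder) :=
    { toFun := fun a => handleShift a.toAdd
      map_one' := by ext <;> simp [handleShift]
      map_mul' := fun a b => by ext v <;> simp [handleShift, add_left_comm, add_comm] }
  have hpow := map_zpow shiftHom (Multiplicative.ofAdd k) n
  rw [← ofAdd_zsmul, smul_eq_mul] at hpow
  exact hpow.symm

theorem handleShift_injective (v : Ladder) : Function.Injective fun k => handleShift k v := by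
  intro k l hkl
  have hx : v.1.1 + (k : ℝ) = v.1.1 + (l : ℝ) := congrArg (fun w : Ladder => w.1.1) hkl
  exact_mod_cast add_left_cancel hx

theorem ladderCover_eq_iff {g : ℕ} {v w : Ladder} :
    ladderCover g v = ladderCover g w ↔ ∃ n : ℤ, handleShift (n * ((g : ℤ) - 1)) v = w := by
  rw [ladderCover, Quotient.eq]
  simp only [← handleShift_zpow]
  rfl

theorem ladderCover_handleShift (g : ℕ) (n : ℤ) (v : Ladder) :
    ladderCover g (handleShift (n * ((g : ℤ) - 1)) v) = ladderCover g v :=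
  (ladderCover_eq_iff.2 ⟨n, rfl⟩).symm

theorem isOpenMap_ladderCover (g : ℕ) : IsOpenMap (ladderCover g) := by
  intro U hU
  have hpreimage : ladderCover g ⁻¹' (ladderCover g '' U) =
      ⋃ n : ℤ, handleShift (n * ((g : ℤ) - 1)) ⁻¹' U := by
    ext v
    simp only [Set.mem_preimage, Set.mem_image, Set.mem_iUnion]
    constructor
    · rintro ⟨u, hu, huv⟩
      obtain ⟨n, rfl⟩ := ladderCover_eq_iff.1 huv.symm
      exact ⟨n, hu⟩
    · rintro ⟨n, hn⟩
      exact ⟨_, hn, ladderCover_handleShift g n v⟩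
  change IsOpen (ladderCover g ⁻¹' (ladderCover g '' U))
  rw [hpreimage]
  exact isOpen_iUnion fun n => hU.preimage (Homeomorph.continuous _)

theorem ladderCover_injOn (g : ℕ) (a : ℝ) :
    Set.InjOn (ladderCover g) {v | |v.1.1 - a| < 1 / 2} := by
  intro v (hv : |v.1.1 - a| < 1 / 2) w (hw : |w.1.1 - a| < 1 / 2) hvw
  obtain ⟨n, hn⟩ := ladderCover_eq_iff.1 hvw
  rw [← hn]
  set k : ℤ := n * ((g : ℤ) - 1)
  have hx : v.1.1 + (k : ℝ) = w.1.1 := congrArg (fun u : Ladder => u.1.1) hn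
  have hk : |(k : ℝ)| < 1 := by
    rw [show (k : ℝ) = (w.1.1 - a) - (v.1.1 - a) by linarith]
    exact (abs_sub _ _).trans_lt (by linarith)
  have hk0 : k = 0 := Int.abs_lt_one_iff.1 (by exact_mod_cast hk)
  ext <;> simp [hk0, handleShift]

theorem isLocalHomeomorph_ladderCover (g : ℕ) : IsLocalHomeomorph (ladderCover g) := by
  rw [isLocalHomeomorph_iff_isOpenEmbedding_restrict]
  intro v
  have hU : IsOpen {w : Ladder | |w.1.1 - v.1.1| < 1 / 2} :=
    isOpen_lt (by fun_prop) continuous_const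
  exact ⟨_, hU.mem_nhds (by simp), .of_continuous_injective_isOpenMap
    (continuous_quot_mk.comp continuous_subtype_val) (ladderCover_injOn g v.1.1).injective
    ((isOpenMap_ladderCover g).comp hU.isOpenEmbedding_subtypeVal.isOpenMap)⟩

/-- The part of the ladder over `0 ≤ x ≤ a`. For `a = g - 1` it contains a fundamental domain of the
cover. -/
def ladderSegment (a : ℝ) : Set Ladder := {v | 0 ≤ v.1.1 ∧ v.1.1 ≤ a}

theorem abs_le_of_mem_ladderSet {v : ℝ × ℝ × ℝ} (hv : v ∈ ladderSet) :
    |v.2.1| ≤ 2 ∧ |v.2.2| ≤ 5 := by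
  obtain ⟨x, y, z⟩ := v
  change z ^ 2 = (4 - y ^ 2) * (y ^ 2 + Real.sin (Real.pi * x) ^ 2 - 1 / 4) at hv
  have hsin := Real.sin_sq_le_one (Real.pi * x)
  have hy : y ^ 2 ≤ 4 := by
    by_contra! hy
    nlinarith [sq_nonneg z, sq_nonneg (Real.sin (Real.pi * x))]
  have hz : z ^ 2 ≤ 25 := by
    have hmul := mul_le_mul_of_nonneg_left
      (show y ^ 2 + Real.sin (Real.pi * x) ^ 2 - 1 / 4 ≤ 5 by linarith) (sub_nonneg.2 hy)
    linarith [sq_nonneg y]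
  exact ⟨abs_le_of_sq_le_sq (by linarith) (by norm_num),
    abs_le_of_sq_le_sq (by linarith) (by norm_num)⟩

theorem isCompact_ladderSegment (a : ℝ) : IsCompact (ladderSegment a) := by
  rw [Subtype.isCompact_iff]
  have himage : Subtype.val '' ladderSegment a = ladderSet ∩ {v | 0 ≤ v.1 ∧ v.1 ≤ a} :=
    Subtype.image_preimage_coe ladderSet {v | 0 ≤ v.1 ∧ v.1 ≤ a}
  have hladder : IsClosed ladderSet := isClosed_eq (by fun_prop) (by fun_prop)
  rw [himage]
  refine (isCompact_Icc (a := ((0, -2, -5) : ℝ × ℝ × ℝ)) (b := (a, 2, 5))).of_isClosed_subset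
    (hladder.inter ((isClosed_le continuous_const continuous_fst).inter
      (isClosed_le continuous_fst continuous_const))) ?_
  rintro v ⟨hv, hx₀, hxa⟩
  obtain ⟨hy, hz⟩ := abs_le_of_mem_ladderSet hv
  exact ⟨⟨hx₀, (abs_le.1 hy).1, (abs_le.1 hz).1⟩, ⟨hxa, (abs_le.1 hy).2, (abs_le.1 hz).2⟩⟩

theorem exists_deck_mem_ladderSegment {g : ℕ} (hg : 2 ≤ g) (v : Ladder) :
    ∃ τ : Ladder ≃ₜ Ladder, (∀ w, ladderCover g (τ w) = ladderCover g w) ∧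
      τ v ∈ ladderSegment ((g : ℝ) - 1) := by
  have hpos : (0 : ℝ) < (g : ℝ) - 1 := sub_pos.2 (by exact_mod_cast hg)
  refine ⟨_, ladderCover_handleShift g (-⌊v.1.1 / ((g : ℝ) - 1)⌋), ?_⟩
  have hfloor := Int.floor_le (v.1.1 / ((g : ℝ) - 1))
  have hlt_floor := (Int.lt_floor_add_one (v.1.1 / ((g : ℝ) - 1))).le
  rw [le_div_iff₀ hpos] at hfloor
  rw [div_le_iff₀ hpos] at hlt_floor
  change 0 ≤ v.1.1 + _ ∧ v.1.1 + _ ≤ _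
  push_cast
  constructor <;> linarith

theorem SingularMeasuredFoliation.Transverse.infinite_sing_lift_ladderCover {g : ℕ} (hg : 2 ≤ g)
    {F G : SingularMeasuredFoliation (ClosedSurface g)} (h : F.Transverse G) :
    (F.lift (isLocalHomeomorph_ladderCover g)).sing.Infinite := by
  obtain ⟨v, hv⟩ := h.nonempty_sing_lift (isLocalHomeomorph_ladderCover g)
    (isCompact_ladderSegment _) (exists_deck_mem_ladderSegment hg) isEmpty_flatStructure_ladder
  refine Set.infinite_of_injective_forall_mem
    (f := fun n : ℤ => handleShift (n * ((g : ℤ) - 1)) v)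
    ((handleShift_injective v).comp (mul_left_injective₀ (by omega))) fun n => ?_
  exact ((hasImage_lift_deck _ F (ladderCover_handleShift g n)).mem_sing_iff v).2 hv

open SingularMeasuredFoliation in
theorem mainTheorem6_general (g : ℕ) (hg : 2 ≤ g)
    (f : ClosedSurface g ≃ₜ ClosedSurface g)
    (Fs Fu : SingularMeasuredFoliation (ClosedSurface g)) (lam : ℝ)
    (hf : IsPseudoAnosov f Fs Fu lam)
    (ft : Ladder ≃ₜ Ladder)
    (hft : ∀ v : Ladder, ladderCover g (ft v) = f (ladderCover g v)) :
    ∃ Fs' Fu' : SingularMeasuredFoliation Ladder,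
      Fs'.Transverse Fu' ∧
      Fs'.IsArational ∧ Fu'.IsArational ∧
      Fs'.HasCountablyInfiniteIsolatedSing ∧ Fu'.HasCountablyInfiniteIsolatedSing ∧
      Fs'.HasImage (ladderCover g) 1 Fs ∧ Fu'.HasImage (ladderCover g) 1 Fu ∧
      Fu'.HasImage ft lam Fu' ∧ Fs'.HasImage ft lam⁻¹ Fs' := by
  have hq := isLocalHomeomorph_ladderCover g
  have hdeck := exists_deck_mem_ladderSegment hg
  have hlam : 0 < lam⁻¹ := inv_pos.2 (one_pos.trans hf.one_lt)
  have hlam_lt : lam⁻¹ < 1 := inv_lt_one_of_one_lt₀ hf.one_lt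
  have hs : (Fs.lift hq).HasImage ft lam⁻¹ (Fs.lift hq) := hf.stable.lift hq ft.continuous hft
  have hu : (Fu.lift hq).HasImage ft lam (Fu.lift hq) := hf.unstable.lift hq ft.continuous hft
  refine ⟨Fs.lift hq, Fu.lift hq, hf.transverse.lift hq, ?_, ?_,
    hasCountablyInfiniteIsolatedSing _ (hf.transverse.infinite_sing_lift_ladderCover hg),
    hasCountablyInfiniteIsolatedSing _ (hf.transverse.symm.infinite_sing_lift_ladderCover hg),
    hasImage_lift hq Fs, hasImage_lift hq Fu, hu, hs⟩
  · exact hf.transverse.isArational_lift hq (isCompact_ladderSegment _) hdeck hlam hlam_lt hs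
      (by rwa [inv_inv])
  -- The unstable foliation is contracted by the inverse of `ft`.
  · exact hf.transverse.symm.isArational_lift hq (isCompact_ladderSegment _) hdeck hlam hlam_lt
      (hu.symm (one_pos.trans hf.one_lt).ne') (hs.symm hlam.ne')

theorem mainTheorem6 (g : ℕ) (hg : 3 ≤ g)
    (f : ClosedSurface g ≃ₜ ClosedSurface g)
    (Fs Fu : SingularMeasuredFoliation (ClosedSurface g)) (lam : ℝ)
    (hf : IsPseudoAnosov f Fs Fu lam)
    (ft : Ladder ≃ₜ Ladder)
    (hft : ∀ v : Ladder, ladderCover g (ft v) = f (ladderCover g v)) :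
    ∃ Fs' Fu' : SingularMeasuredFoliation Ladder,
      Fs'.Transverse Fu' ∧
      Fs'.IsArational ∧ Fu'.IsArational ∧
      Fs'.HasCountablyInfiniteIsolatedSing ∧ Fu'.HasCountablyInfiniteIsolatedSing ∧
      Fs'.HasImage (ladderCover g) 1 Fs ∧ Fu'.HasImage (ladderCover g) 1 Fu ∧
      Fu'.HasImage ft lam Fu' ∧ Fs'.HasImage ft lam⁻¹ Fs' :=
  mainTheorem6_general g (by omega) f Fs Fu lam hf ft hft
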